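/- **Model.** In the Bilateral Network Creation Game with $n$ agents and edge price $\alpha>0$, a state is a simple undirected graph $G=(V,E)$ on the set $V$ of agents. The distance $\mathrm{dist}_G(u,v)$ is the number of edges of a shortest $u$–$v$ path, or a fixed constant $M\in\mathbb N$ with $M>\alpha n^3$ if there is no such path. The cost of agent $u$ is $\mathrm{cost}_G(u)=\alpha\deg_G(u)+\sum_{v\in V}\mathrm{dist}_G(u,v)$, the social cost of $G$ is $\mathrm{cost}(G)=\sum_{u\in V}\mathrm{cost}_G(u)$, and the social cost ratio of $G$ is $\rho(G)=\mathrm{cost}(G)/\min_H \mathrm{cost}(H)$, where $H$ ranges over all graphs with $n$ nodes. The graph $G$ is in *Bilateral Neighborhood Equilibrium* (BNE) if there are no agent $u$, set $R$ of neighbors of $u$ and set $A\subseteq V\setminus\{u\}$ of non-neighbors of $u$ such that $u$ and all agents in $A$ have strictly lower cost after simultaneously removing all edges between $u$ and $R$ and adding all edges between $u$ and $A$. **Theorem.** (i) For every $0<\varepsilon\le 1$ there is an $N\in\mathbb N$ (depending only on $\varepsilon$) such that for all $\eta\in\mathbb N$ with $\eta\ge N$ and all real $\alpha$ with $9\eta\le\alpha\le\eta^{2-\varepsilon}$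 there is a tree $G$ with $n$ nodes, $\eta\le n\le\frac32\eta$, which for every admissible $M$ is in BNE and satisfies $$\rho(G)\ \ge\ \frac{\varepsilon}{168}\log_2\alpha-\frac{3}{28}.$$ (ii) For every $0<\varepsilon\le\frac12$ there is an $N\in\mathbb N$ (depending only on $\varepsilon$) such that for all $\eta\in\mathbb N$ with $\eta\ge N$ and all real $\alpha$ with $\eta^{1/2+\varepsilon}\le\alpha\le\eta$ there is a tree $G$ with $n$ nodes, $\eta\le n\le\frac32\eta$, which for every admissible $M$ is in BNE and satisfies $$\rho(G)\ \ge\ \frac{\varepsilon}{4}\log_2\alpha-\frac{9}{8}.$$ -/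

import Mathlib

open scoped Classical in
/-- Distance between two agents: hop distance if they are connected in `G`, and the large
constant `M` otherwise. -/
noncomputable def agentDist {V : Type*} (M : ℕ) (G : SimpleGraph V) (u v : V) : ℝ :=
  if G.Reachable u v then (G.dist u v : ℝ) else (M : ℝ)

/-- Total cost of agent `u` in the bilateral network creation game with edge price `α`: every
endpoint of an edge pays `α` for it, plus the sum of the distances to all agents. -/
noncomputable def agentCost {V : Type*} [Fintype V] (α : ℝ) (M : ℕ) (G : SimpleGraph V)
    (u : V) : ℝ :=
  α * ((G.neighborSet u).ncard : ℝ) + ∑ v : V, agentDist M G u v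

/-- Social cost: the sum of the costs of all agents. -/
noncomputable def socialCost {V : Type*} [Fintype V] (α : ℝ) (M : ℕ) (G : SimpleGraph V) : ℝ :=
  ∑ u : V, agentCost α M G u

/-- The social cost of a social optimum, i.e. the least social cost of a graph on the agents `V`
(a minimum over finitely many graphs, see `exists_socialCost_eq_optCost`). -/
noncomputable def optCost (V : Type*) [Fintype V] (α : ℝ) (M : ℕ) : ℝ :=
  ⨅ H : SimpleGraph V, socialCost α M H

theorem exists_socialCost_eq_optCost (V : Type*) [Fintype V] (α : ℝ) (M : ℕ) :
    ∃ H : SimpleGraph V, socialCost α M H = optCost V α M ∧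
      ∀ H' : SimpleGraph V, socialCost α M H ≤ socialCost α M H' := by
  obtain ⟨H, hH⟩ := Finite.exists_min (fun H : SimpleGraph V => socialCost α M H)
  refine ⟨H, le_antisymm (le_ciInf hH) ?_, hH⟩
  exact ciInf_le (Set.finite_range _).bddBelow H

/-- Social cost ratio `ρ(G)`: social cost of `G` divided by that of a social optimum. -/
noncomputable def socialCostRatio {V : Type*} [Fintype V] (α : ℝ) (M : ℕ)
    (G : SimpleGraph V) : ℝ :=
  socialCost α M G / optCost V α M

/-- The graph whose edges are exactly those between `u` and the members of `X` (other than `u`). -/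
def edgesTo {V : Type*} (u : V) (X : Set V) : SimpleGraph V :=
  SimpleGraph.fromRel (fun x y => x = u ∧ y ∈ X)

/-- The graph after agent `u` removes her edges to `R` and adds edges to `A`. -/
def neighborhoodChange {V : Type*} (G : SimpleGraph V) (u : V) (R A : Set V) : SimpleGraph V :=
  (G \ edgesTo u R) ⊔ edgesTo u A

/-- Bilateral Neighborhood Equilibrium: there is no agent `u` with a set `R` of neighbors and a
set `A` of non-neighbors such that `u` and all agents in `A` strictly decrease their cost if `u`
simultaneously removes her edges to `R` and adds edges to `A`. -/
def IsBNE {V : Type*} [Fintype V] (α : ℝ) (M : ℕ) (G : SimpleGraph V) : Prop :=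
  ¬ ∃ (u : V) (R A : Set V),
      (∀ v ∈ R, G.Adj u v) ∧
      (∀ v ∈ A, v ≠ u ∧ ¬ G.Adj u v) ∧
      agentCost α M (neighborhoodChange G u R A) u < agentCost α M G u ∧
      ∀ v ∈ A, agentCost α M (neighborhoodChange G u R A) v < agentCost α M G v

/-! The witness is a root with `m` copies of a binary tree of `d` levels attached, each binary node
stretched to a path of `k + 1` vertices. Most pairs lie in different copies, where distance is the
sum of depths, and about half of all vertices have depth at least `(k + 1) * (d - 1)`. The distances
thus cost about `n ^ 2 * (k + 1) * d`, while a star costs at most `2 * α * n + 2 * n ^ 2`. With `k +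
1` about `α / (15 * η)` for large `α`, and `k = 0` for `α ≤ η`, the ratio is of order `d`, and the
equilibrium condition leaves room for `d` of order `ε * log η`.

Equilibrium (`not_improving`, `isBNE`). Since `M` is huge, an improving move of `u` keeps the graph
connected. If `t` bounds the branches at the root and `D` the depth, no one gains more than `2 * t *
D` in one branch, and `u` buys fewer than `2 * D * n / α` net edges because her total gain is at
most `2 * D * n`. If `u` drops her parent, or gets a new neighbor outside her subtree of depth at
most her own plus one, the shallowest new neighbor outside gains only in the branches touched by the
move (`dist_le_dist_change_of_shallow`), which is less than `α`. Otherwise the gain of `u` above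
herself is confined to the touched branches (`dist_le_dist_change_of_deep`). Below a child it is at
most `2 * t * D` per surplus edge, unless that child is exchanged for exactly one descendant `v`
(`gain_below_child`). Without such an exchange the edges of `u` do not pay off. With one, `v`
reaches the rest only through `u` and gains little (`sum_dist_sub_le_of_swap`), provided `v` is
close to the child. That proviso is `sum_swap_nonpos_or`: subtree sizes halve from level to level,
so a vertex far below a child is too eccentric to be a better entrance to its subtree.

All lower bounds on distances after a move come from potentials: a function changing by at most one
along every edge bounds distances from below. -/

/-- A distance in a graph is at least the increment of any function that grows by at most `1`
along every edge. -/
theorem SimpleGraph.Reachable.sub_le_dist {V : Type*} {G : SimpleGraph V} {x y : V}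
    (h : G.Reachable x y) (f : V → ℤ) (hf : ∀ a b, G.Adj a b → f b ≤ f a + 1) :
    f y - f x ≤ G.dist x y := by
  have key : ∀ (a b : V) (p : G.Walk a b), f b - f a ≤ p.length := by
    intro a b p
    induction p with
    | nil => simp
    | cons hab q ih =>
      have := hf _ _ hab
      simp only [SimpleGraph.Walk.length_cons, Nat.cast_add, Nat.cast_one]
      linarith
  obtain ⟨p, hp⟩ := h.exists_walk_length_eq_dist
  rw [← hp]
  exact key x y p

/-! ### Rooted trees: ancestors, branches at the root, distances -/

/-- A tree given by a root, the parent of every vertex and its distance from the root. -/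
structure ParentTree (V : Type*) where
  /-- The root. -/
  root : V
  /-- The parent; the root is its own parent. -/
  parent : V → V
  /-- The distance from the root. -/
  depth : V → ℕ
  parent_root : parent root = root
  depth_root : depth root = 0
  depth_parent : ∀ v, v ≠ root → depth (parent v) + 1 = depth v

namespace ParentTree

variable {V : Type*} (T : ParentTree V)

/-- The graph that joins every vertex to its parent. -/
def graph : SimpleGraph V := SimpleGraph.fromRel (fun x y => T.parent x = y)

theorem parent_ne {x : V} (hx : x ≠ T.root) : T.parent x ≠ x := by
  intro h
  have := T.depth_parent x hx
  rw [h] at this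
  omega

theorem adj_iff {x y : V} : T.graph.Adj x y ↔
    (x ≠ T.root ∧ T.parent x = y) ∨ (y ≠ T.root ∧ T.parent y = x) := by
  rw [graph, SimpleGraph.fromRel_adj]
  constructor
  · rintro ⟨hne, h | h⟩
    · refine Or.inl ⟨?_, h⟩
      rintro rfl
      exact hne (T.parent_root.symm.trans h)
    · refine Or.inr ⟨?_, h⟩
      rintro rfl
      exact hne (h.symm.trans T.parent_root)
  · rintro (⟨hx, rfl⟩ | ⟨hy, rfl⟩)
    · exact ⟨(T.parent_ne hx).symm, Or.inl rfl⟩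
    · exact ⟨T.parent_ne hy, Or.inr rfl⟩

theorem adj_parent {x : V} (hx : x ≠ T.root) : T.graph.Adj x (T.parent x) :=
  T.adj_iff.2 (Or.inl ⟨hx, rfl⟩)

theorem depth_eq_zero {x : V} : T.depth x = 0 ↔ x = T.root := by
  constructor
  · intro h
    by_contra hx
    have := T.depth_parent x hx
    omega
  · rintro rfl
    exact T.depth_root

theorem depth_iterate (x : V) (i : ℕ) : T.depth (T.parent^[i] x) = T.depth x - i := by
  induction i with
  | zero => simp
  | succ i ih =>
    rw [Function.iterate_succ_apply']
    by_cases h : T.parent^[i] x = T.root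
    · rw [h] at ih ⊢
      rw [T.depth_root] at ih
      rw [T.parent_root, T.depth_root]
      omega
    · have := T.depth_parent _ h
      omega

/-- `x` is `z` or a descendant of `z`. -/
def Desc (z x : V) : Prop := ∃ i, T.parent^[i] x = z

theorem Desc.refl (x : V) : T.Desc x x := ⟨0, rfl⟩

variable {T} in
theorem Desc.trans {x y z : V} (h : T.Desc x y) (h' : T.Desc y z) : T.Desc x z := by
  obtain ⟨i, rfl⟩ := h
  obtain ⟨j, rfl⟩ := h'
  exact ⟨i + j, Function.iterate_add_apply _ _ _ _⟩

theorem desc_parent (x : V) : T.Desc (T.parent x) x := ⟨1, rfl⟩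

variable {T} in
theorem not_desc_parent {z x : V} (h : ¬ T.Desc z x) : ¬ T.Desc z (T.parent x) :=
  fun h' => h (h'.trans (T.desc_parent x))

variable {T} in
theorem Desc.parent_of_ne {z x : V} (h : T.Desc z x) (hne : x ≠ z) : T.Desc z (T.parent x) := by
  obtain ⟨i, rfl⟩ := h
  cases i with
  | zero => exact absurd rfl hne
  | succ i => exact ⟨i, rfl⟩

variable {T} in
theorem Desc.depth_le {z x : V} (h : T.Desc z x) : T.depth z ≤ T.depth x := by
  obtain ⟨i, rfl⟩ := h
  rw [T.depth_iterate]
  omega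

variable {T} in
theorem Desc.iterate_eq {z x : V} (h : T.Desc z x) :
    T.parent^[T.depth x - T.depth z] x = z := by
  obtain ⟨i, rfl⟩ := h
  rw [T.depth_iterate]
  rcases le_total i (T.depth x) with hi | hi
  · rw [Nat.sub_sub_self hi]
  · have h1 : T.parent^[i] x = T.root := by
      rw [← T.depth_eq_zero, T.depth_iterate]
      omega
    rw [h1, ← T.depth_eq_zero, T.depth_iterate]
    omega

variable {T} in
theorem Desc.eq_of_depth {z z' x : V} (h : T.Desc z x) (h' : T.Desc z' x)
    (hd : T.depth z = T.depth z') : z = z' := by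
  rw [← h.iterate_eq, hd, h'.iterate_eq]

theorem desc_root (x : V) : T.Desc T.root x :=
  ⟨T.depth x, by rw [← T.depth_eq_zero, T.depth_iterate]; omega⟩

variable {T} in
theorem Desc.ne_root {z x : V} (h : T.Desc z x) (hz : z ≠ T.root) : x ≠ T.root := by
  rintro rfl
  apply hz
  rw [← T.depth_eq_zero]
  have := h.depth_le
  rw [T.depth_root] at this
  omega

/-- The first vertex on the way from the root to `x`. -/
def branch (x : V) : V := T.parent^[T.depth x - 1] x

theorem desc_branch (x : V) : T.Desc (T.branch x) x := ⟨_, rfl⟩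

theorem depth_branch {x : V} (hx : x ≠ T.root) : T.depth (T.branch x) = 1 := by
  have : T.depth x ≠ 0 := fun h => hx (T.depth_eq_zero.1 h)
  rw [branch, T.depth_iterate]
  omega

theorem branch_eq_of_desc {z x : V} (hz : z ≠ T.root) (h : T.Desc z x) :
    T.branch x = T.branch z :=
  Desc.eq_of_depth (T.desc_branch x) ((T.desc_branch z).trans h)
    (by rw [T.depth_branch (h.ne_root hz), T.depth_branch hz])

theorem dist_le_of_desc {z x : V} (h : T.Desc z x) :
    T.graph.Reachable x z ∧ T.graph.dist x z + T.depth z ≤ T.depth x := by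
  obtain ⟨i, rfl⟩ := h
  induction i with
  | zero => simp
  | succ i ih =>
    rw [Function.iterate_succ_apply']
    by_cases h : T.parent^[i] x = T.root
    · rw [h, T.parent_root, ← h]
      exact ih
    · have h1 := T.adj_parent h
      have h2 := T.depth_parent _ h
      refine ⟨ih.1.trans h1.reachable, ?_⟩
      have h3 := ih.1.dist_triangle_left (T.parent (T.parent^[i] x))
      rw [SimpleGraph.dist_eq_one_iff_adj.2 h1] at h3
      have := ih.2
      omega

theorem connected : T.graph.Connected where
  preconnected x y :=
    (T.dist_le_of_desc (T.desc_root x)).1.trans (T.dist_le_of_desc (T.desc_root y)).1.symm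
  nonempty := ⟨T.root⟩

theorem adj_rec {P : V → V → Prop} (hs : ∀ x y, P x y → P y x)
    (h : ∀ x, x ≠ T.root → P x (T.parent x)) {x y : V} (hxy : T.graph.Adj x y) : P x y := by
  rcases T.adj_iff.1 hxy with ⟨hx, rfl⟩ | ⟨hy, rfl⟩
  · exact h x hx
  · exact hs _ _ (h y hy)

theorem abs_sub_le_dist (f : V → ℤ) (hf : ∀ x, x ≠ T.root → |f x - f (T.parent x)| ≤ 1)
    (x y : V) : |f x - f y| ≤ T.graph.dist x y := by
  have h1 : ∀ {a b : V}, T.graph.Adj a b → |f a - f b| ≤ 1 := fun hab =>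
    T.adj_rec (P := fun a b => |f a - f b| ≤ 1) (fun a b h => by rwa [abs_sub_comm]) hf hab
  rw [abs_le]
  constructor
  · have := (T.connected y x).sub_le_dist f (fun a b hab => by
      have := abs_le.1 (h1 hab); linarith)
    have := (T.connected x y).sub_le_dist f (fun a b hab => by
      have := abs_le.1 (h1 hab); linarith)
    linarith
  · have := (T.connected y x).sub_le_dist f (fun a b hab => by
      have := abs_le.1 (h1 hab); linarith)
    rw [SimpleGraph.dist_comm]
    linarith

theorem dist_of_desc {z x : V} (h : T.Desc z x) : T.graph.dist z x + T.depth z = T.depth x := by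
  have h1 := (T.dist_le_of_desc h).2
  have h2 := T.abs_sub_le_dist (fun v => (T.depth v : ℤ)) (fun v hv => by
    have := T.depth_parent v hv
    rw [abs_le]; constructor <;> simp <;> omega) x z
  have := (abs_le.1 h2).2
  rw [SimpleGraph.dist_comm]
  omega

theorem dist_le_depth_add (x y : V) : T.graph.dist x y ≤ T.depth x + T.depth y := by
  have h1 := T.connected.dist_triangle (u := x) (v := T.root) (w := y)
  have h2 := T.dist_of_desc (T.desc_root x)
  have h3 := T.dist_of_desc (T.desc_root y)
  rw [T.depth_root] at h2 h3
  rw [SimpleGraph.dist_comm (u := T.root) (v := x)] at h2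
  omega

/-- Two vertices in different branches. -/
theorem dist_eq_depth_add {x y : V} (hx : x ≠ T.root) (h : T.branch x ≠ T.branch y) :
    T.graph.dist x y = T.depth x + T.depth y := by
  classical
  refine le_antisymm (T.dist_le_depth_add x y) ?_
  -- The potential is the depth, with its sign flipped outside the branch of `x`; it passes through
  -- 0 at the root.
  have h2 := T.abs_sub_le_dist
    (fun v => if T.Desc (T.branch x) v then (T.depth v : ℤ) else -(T.depth v : ℤ)) (fun v hv => by
      have h0 := T.depth_parent v hv
      by_cases hb : T.Desc (T.branch x) v
      · by_cases he : v = T.branch x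
        · have h1 : T.depth v = 1 := by rw [he, T.depth_branch hx]
          have h2 : T.depth (T.parent v) = 0 := by omega
          rw [if_pos hb]
          split_ifs <;> simp [h1, h2]
        · rw [if_pos hb, if_pos (hb.parent_of_ne he), abs_le]
          constructor <;> push_cast [← h0] <;> linarith
      · rw [if_neg hb, if_neg (fun h => hb (h.trans (T.desc_parent v))), abs_le]
        constructor <;> push_cast [← h0] <;> linarith) x y
  have hy : ¬ T.Desc (T.branch x) y := by
    intro hd
    have hb : T.branch x ≠ T.root := by
      intro hr
      have := T.depth_branch hx
      rw [hr, T.depth_root] at this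
      omega
    have h1 := T.branch_eq_of_desc hb hd
    have h3 := T.branch_eq_of_desc hb (T.desc_branch x)
    exact h (h3.trans h1.symm)
  simp only [if_pos (T.desc_branch x), if_neg hy] at h2
  have := (abs_le.1 h2).2
  omega

/-! ### Subtrees of finite rooted trees -/

section Finite

variable [Fintype V]

theorem isTree : T.graph.IsTree := by
  classical
  rw [SimpleGraph.isTree_iff_connected_and_card]
  refine ⟨T.connected, ?_⟩
  -- The non-root vertices biject with the edges by `v ↦ s(v, parent v)`, so there is one edge fewer
  -- than vertices.
  have h : T.graph.edgeSet = (fun v => s(v, T.parent v)) '' {v | v ≠ T.root} := by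
    ext e
    induction e with
    | h x y =>
      rw [SimpleGraph.mem_edgeSet, T.adj_iff]
      simp only [Set.mem_image, Set.mem_ofPred_eq]
      constructor
      · rintro (⟨hx, rfl⟩ | ⟨hy, rfl⟩)
        · exact ⟨x, hx, rfl⟩
        · exact ⟨y, hy, Sym2.eq_swap⟩
      · rintro ⟨v, hv, he⟩
        rw [Sym2.eq_iff] at he
        rcases he with ⟨rfl, rfl⟩ | ⟨rfl, rfl⟩
        · exact Or.inl ⟨hv, rfl⟩
        · exact Or.inr ⟨hv, rfl⟩
  have hinj : Set.InjOn (fun v => s(v, T.parent v)) {v | v ≠ T.root} := by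
    intro x hx y hy he
    simp only [Sym2.eq_iff] at he
    rcases he with ⟨h, _⟩ | ⟨h1, h2⟩
    · exact h
    · exfalso
      have e1 := T.depth_parent x hx
      have e2 := T.depth_parent y hy
      rw [h2] at e1
      rw [← h1] at e2
      omega
  rw [h, Nat.card_coe_set_eq, hinj.ncard_image]
  have h1 : {v | v ≠ T.root} = ({T.root} : Set V)ᶜ := rfl
  have h2 := Set.ncard_add_ncard_compl ({T.root} : Set V)
  rw [h1]
  rw [Set.ncard_singleton] at h2
  omega

open scoped Classical in
/-- `z` and its descendants. -/
noncomputable def below (z : V) : Finset V := Finset.univ.filter (fun x => T.Desc z x)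

open scoped Classical in
/-- The children of `z`. -/
noncomputable def children (z : V) : Finset V :=
  Finset.univ.filter (fun c => c ≠ T.root ∧ T.parent c = z)

variable {T}

theorem mem_below {z x : V} : x ∈ T.below z ↔ T.Desc z x := by simp [below]

theorem mem_children {z c : V} : c ∈ T.children z ↔ c ≠ T.root ∧ T.parent c = z := by
  simp [children]

theorem exists_child_desc {z x : V} (h : T.Desc z x) (hne : x ≠ z) :
    ∃ c ∈ T.children z, T.Desc c x := by
  obtain ⟨i, hi⟩ := h
  induction i generalizing x with
  | zero => exact absurd hi hne
  | succ i ih =>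
    by_cases hp : T.parent x = z
    · refine ⟨x, mem_children.2 ⟨?_, hp⟩, Desc.refl T x⟩
      rintro rfl
      exact hne (T.parent_root.symm.trans hp)
    · obtain ⟨c, hc, hcx⟩ := ih hp hi
      exact ⟨c, hc, hcx.trans (T.desc_parent x)⟩

theorem desc_of_mem_children {z c : V} (hc : c ∈ T.children z) : T.Desc z c := by
  rw [← (mem_children.1 hc).2]
  exact T.desc_parent c

theorem depth_of_mem_children {z c : V} (hc : c ∈ T.children z) : T.depth c = T.depth z + 1 := by
  rw [← T.depth_parent c (mem_children.1 hc).1, (mem_children.1 hc).2]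

theorem sum_below {M : Type*} [AddCommMonoid M] (z : V) (f : V → M) :
    ∑ x ∈ T.below z, f x = f z + ∑ c ∈ T.children z, ∑ x ∈ T.below c, f x := by
  classical
  have h1 : T.below z = insert z ((T.children z).biUnion T.below) := by
    ext x
    simp only [Finset.mem_insert, Finset.mem_biUnion, mem_below]
    constructor
    · intro h
      by_cases hx : x = z
      · exact Or.inl hx
      · exact Or.inr (exists_child_desc h hx)
    · rintro (rfl | ⟨c, hc, hcx⟩)
      · exact Desc.refl T x
      · exact (desc_of_mem_children hc).trans hcx
  rw [h1, Finset.sum_insert, Finset.sum_biUnion]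
  · intro c hc c' hc' hne
    rw [Function.onFun, Finset.disjoint_left]
    intro x hx hx'
    rw [mem_below] at hx hx'
    exact hne (hx.eq_of_depth hx'
      (by rw [depth_of_mem_children hc, depth_of_mem_children hc']))
  · simp only [Finset.mem_biUnion, mem_below, not_exists, not_and]
    intro c hc h
    have := h.depth_le
    rw [depth_of_mem_children hc] at this
    omega

theorem card_below_le {t : ℕ} (ht : ∀ b, T.depth b = 1 → (T.below b).card ≤ t) {c : V}
    (hc : c ≠ T.root) : (T.below c).card ≤ t := by
  refine le_trans (Finset.card_le_card ?_) (ht _ (T.depth_branch hc))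
  intro x hx
  rw [mem_below] at hx ⊢
  exact (T.desc_branch c).trans hx

end Finite

end ParentTree

/-! ### The graph after a move, and potentials on it -/

theorem edgesTo_adj {V : Type*} {u : V} {X : Set V} {x y : V} :
    (edgesTo u X).Adj x y ↔ x ≠ y ∧ ((x = u ∧ y ∈ X) ∨ (y = u ∧ x ∈ X)) := by
  simp [edgesTo, SimpleGraph.fromRel_adj]

theorem neighborhoodChange_adj {V : Type*} {G : SimpleGraph V} {u : V} {R A : Set V} {x y : V} :
    (neighborhoodChange G u R A).Adj x y ↔
      (G.Adj x y ∧ ¬(x = u ∧ y ∈ R) ∧ ¬(y = u ∧ x ∈ R)) ∨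
      (x ≠ y ∧ ((x = u ∧ y ∈ A) ∨ (y = u ∧ x ∈ A))) := by
  simp only [neighborhoodChange, SimpleGraph.sup_adj, SimpleGraph.sdiff_adj, edgesTo_adj]
  constructor
  · rintro (⟨h1, h2⟩ | h)
    · exact Or.inl ⟨h1, fun h => h2 ⟨h1.ne, Or.inl h⟩, fun h => h2 ⟨h1.ne, Or.inr h⟩⟩
    · exact Or.inr h
  · rintro (⟨h1, h2, h3⟩ | h)
    · exact Or.inl ⟨h1, fun h => h.2.elim h2 h3⟩
    · exact Or.inr h

theorem abs_dist_sub_dist_le {V : Type*} {G : SimpleGraph V} (hG : G.Connected) {a b : V}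
    (hab : G.dist a b ≤ 1) (z : V) : |(G.dist z a : ℤ) - G.dist z b| ≤ 1 := by
  have h1 := hG.dist_triangle (u := z) (v := a) (w := b)
  have h2 := hG.dist_triangle (u := z) (v := b) (w := a)
  rw [SimpleGraph.dist_comm (u := b) (v := a)] at h2
  rw [abs_le]
  omega

namespace ParentTree

variable {V : Type*} {T : ParentTree V} {u : V} {R A : Set V}

/-- The surviving tree edges and the new edges at `u` are the only edges after the move, so a
potential has to be checked on these two kinds alone. -/
theorem sub_le_dist_change (hconn : (neighborhoodChange T.graph u R A).Connected) (f : V → ℤ)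
    (hf : ∀ x, x ≠ T.root → ¬(T.parent x = u ∧ x ∈ R) → ¬(x = u ∧ T.parent x ∈ R) →
      |f x - f (T.parent x)| ≤ 1)
    (hA : ∀ a ∈ A, |f u - f a| ≤ 1) (x y : V) :
    f y - f x ≤ (neighborhoodChange T.graph u R A).dist x y := by
  refine (hconn x y).sub_le_dist f ?_
  intro a b hab
  rcases neighborhoodChange_adj.1 hab with ⟨h, h1, h2⟩ | ⟨-, ⟨rfl, h⟩ | ⟨rfl, h⟩⟩
  · rcases T.adj_iff.1 h with ⟨hr, rfl⟩ | ⟨hr, rfl⟩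
    · have := abs_le.1 (hf a hr h2 h1)
      linarith
    · have := abs_le.1 (hf b hr h1 h2)
      linarith
  · have := abs_le.1 (hA b h)
    linarith
  · have := abs_le.1 (hA a h)
    linarith

/-! ### Components below a removed or untouched child -/

theorem not_desc_of_parent_eq {c : V} (hc : c ≠ T.root) (hcu : T.parent c = u) :
    ¬ T.Desc c u := by
  intro h
  have h1 := h.depth_le
  have h2 := T.depth_parent c hc
  rw [hcu] at h2
  omega

/-- Without a new edge into the part below `c`, that part would be cut off. The potential makes this
a contradiction: it is 0 outside and one more than the supposed distance inside. -/
theorem exists_mem_desc_of_removed (hconn : (neighborhoodChange T.graph u R A).Connected) {c : V}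
    (hc : c ≠ T.root) (hcu : T.parent c = u) (hcR : c ∈ R) : ∃ a ∈ A, T.Desc c a := by
  classical
  by_contra! hno
  have hu := not_desc_of_parent_eq hc hcu
  have := sub_le_dist_change hconn (fun y => if T.Desc c y then
    ((neighborhoodChange T.graph u R A).dist u c : ℤ) + 1 else 0) (fun x hx h1 h2 => by
      by_cases hd : T.Desc c x
      · have : x ≠ c := by
          rintro rfl
          exact h1 ⟨hcu, hcR⟩
        simp [hd, hd.parent_of_ne this]
      · simp [hd, not_desc_parent hd])
    (fun a ha => by simp [hu, hno a ha]) u c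
  simp [hu, Desc.refl T c] at this

theorem exists_mem_not_desc_of_removed (hconn : (neighborhoodChange T.graph u R A).Connected)
    (hu : u ≠ T.root) (huR : T.parent u ∈ R) : ∃ a ∈ A, ¬ T.Desc u a := by
  classical
  by_contra! hno
  have hp := not_desc_of_parent_eq hu rfl
  have := sub_le_dist_change hconn (fun y => if T.Desc u y then
    ((neighborhoodChange T.graph u R A).dist (T.parent u) u : ℤ) + 1 else 0)
    (fun x hx h1 h2 => by
      by_cases hd : T.Desc u x
      · have : x ≠ u := by
          rintro rfl
          exact h2 ⟨rfl, huR⟩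
        simp [hd, hd.parent_of_ne this]
      · simp [hd, not_desc_parent hd])
    (fun a ha => by simp [Desc.refl T u, hno a ha]) (T.parent u) u
  simp [hp, Desc.refl T u] at this

/-- The only possible entrance to the part below `c` is still the edge from `u`, so the old distance
from `u`, set to 0 elsewhere, remains a potential. -/
theorem dist_le_dist_change_of_untouched (hconn : (neighborhoodChange T.graph u R A).Connected)
    {c : V} (hc : c ≠ T.root) (hcu : T.parent c = u) (hA : ∀ a ∈ A, ¬ T.Desc c a)
    {w : V} (hw : T.Desc c w) :
    T.graph.dist u w ≤ (neighborhoodChange T.graph u R A).dist u w := by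
  classical
  have hu := not_desc_of_parent_eq hc hcu
  have := sub_le_dist_change hconn (fun y => if T.Desc c y then (T.graph.dist u y : ℤ) else 0)
    (fun x hx h1 h2 => by
      by_cases hd : T.Desc c x
      · by_cases hxc : x = c
        · subst hxc
          have h3 : T.graph.dist u x = 1 :=
            SimpleGraph.dist_eq_one_iff_adj.2 (hcu ▸ (T.adj_parent hx).symm)
          rw [hcu]
          simp [hd, hu, h3]
        · simp only [hd, hd.parent_of_ne hxc, if_true]
          exact abs_dist_sub_dist_le T.connected
            (SimpleGraph.dist_eq_one_iff_adj.2 (T.adj_parent hx)).le u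
      · simp [hd, not_desc_parent hd])
    (fun a ha => by simp [hu, hA a ha]) u w
  simp only [hu, hw, if_true, if_false, sub_zero] at this
  exact_mod_cast this

/-! ### A child `c` exchanged for a single descendant `v` -/

section Swap

variable (hconn : (neighborhoodChange T.graph u R A).Connected) {c v : V}
  (hc : c ≠ T.root) (hcu : T.parent c = u) (hcR : c ∈ R) (hv : T.Desc c v)
  (hvA : ∀ a ∈ A, T.Desc c a → a = v)

include hconn hc hcu hcR hv hvA

/-- The part below `c` now hangs on the single edge between `u` and `v`, so a potential supported
there has to be tame only inside and at `v`. -/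
theorem sub_le_dist_change_of_swap {f : V → ℤ}
    (hf : ∀ x, x ≠ T.root → T.Desc c x → T.Desc c (T.parent x) → |f x - f (T.parent x)| ≤ 1)
    (hf0 : ∀ x, ¬ T.Desc c x → f x = 0) (hfv : |f v| ≤ 1) (x y : V) :
    f y - f x ≤ (neighborhoodChange T.graph u R A).dist x y := by
  have hu := not_desc_of_parent_eq hc hcu
  refine sub_le_dist_change hconn f ?_ ?_ x y
  · intro x hx h1 h2
    by_cases hd : T.Desc c x
    · have hne : x ≠ c := by
        rintro rfl
        exact h1 ⟨hcu, hcR⟩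
      exact hf x hx hd (hd.parent_of_ne hne)
    · rw [hf0 x hd, hf0 _ (not_desc_parent hd)]
      simp
  · intro a ha
    rw [hf0 u hu, zero_sub, abs_neg]
    by_cases hd : T.Desc c a
    · rw [hvA a ha hd]
      exact hfv
    · rw [hf0 a hd]
      simp

theorem succ_dist_le_dist_change_of_swap {w : V} (hw : T.Desc c w) :
    T.graph.dist v w + 1 ≤ (neighborhoodChange T.graph u R A).dist u w := by
  classical
  have hu := not_desc_of_parent_eq hc hcu
  have := sub_le_dist_change_of_swap hconn hc hcu hcR hv hvA
    (f := fun y => if T.Desc c y then (T.graph.dist v y : ℤ) + 1 else 0)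
    (fun x hx h1 h2 => by
      simp only [h1, h2, if_true, add_sub_add_right_eq_sub]
      exact abs_dist_sub_dist_le T.connected
        (SimpleGraph.dist_eq_one_iff_adj.2 (T.adj_parent hx)).le v)
    (fun x hx => by simp [hx]) (by simp [hv]) u w
  simp only [hu, hw, if_true, if_false, sub_zero] at this
  exact_mod_cast this

theorem dist_le_dist_change_of_swap {w : V} (hw : T.Desc c w) :
    T.graph.dist v w ≤ (neighborhoodChange T.graph u R A).dist v w := by
  classical
  have := sub_le_dist_change_of_swap hconn hc hcu hcR hv hvA
    (f := fun y => if T.Desc c y then (T.graph.dist v y : ℤ) else 0)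
    (fun x hx h1 h2 => by
      simp only [h1, h2, if_true]
      exact abs_dist_sub_dist_le T.connected
        (SimpleGraph.dist_eq_one_iff_adj.2 (T.adj_parent hx)).le v)
    (fun x hx => by simp [hx]) (by simp) v w
  simp only [hv, hw, if_true, SimpleGraph.dist_self, Nat.cast_zero, sub_zero] at this
  exact_mod_cast this

/-- Every path from `v` out of the part below `c` uses the edge to `u`, hence `v` is one step
farther than `u` from everything outside. -/
theorem succ_dist_change_le_of_swap {w : V} (hw : ¬ T.Desc c w) :
    (neighborhoodChange T.graph u R A).dist u w + 1 ≤
      (neighborhoodChange T.graph u R A).dist v w := by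
  classical
  have hu := not_desc_of_parent_eq hc hcu
  have := sub_le_dist_change hconn (fun y => if T.Desc c y then 0 else
    ((neighborhoodChange T.graph u R A).dist u y : ℤ) + 1)
    (fun x hx h1 h2 => by
      by_cases hd : T.Desc c x
      · have hne : x ≠ c := by
          rintro rfl
          exact h1 ⟨hcu, hcR⟩
        simp [hd, hd.parent_of_ne hne]
      · simp only [hd, not_desc_parent hd, if_false,
          add_sub_add_right_eq_sub]
        refine abs_dist_sub_dist_le hconn (SimpleGraph.dist_eq_one_iff_adj.2 ?_).le u
        exact neighborhoodChange_adj.2 (Or.inl ⟨T.adj_parent hx, h2, h1⟩))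
    (fun a ha => by
      by_cases hd : T.Desc c a
      · simp [hu, hd]
      · have hadj : (neighborhoodChange T.graph u R A).dist u a ≤ 1 := by
          by_cases hua : u = a
          · simp [hua]
          · exact (SimpleGraph.dist_eq_one_iff_adj.2
              (neighborhoodChange_adj.2 (Or.inr ⟨hua, Or.inl ⟨rfl, ha⟩⟩))).le
        simp only [hu, hd, if_false, add_sub_add_right_eq_sub]
        rw [SimpleGraph.dist_self, abs_le]
        constructor <;> push_cast <;> omega) v w
  simp only [hv, hw, if_true, if_false, sub_zero] at this
  exact_mod_cast this

end Swap

/-! ### Touched branches -/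

section Touched

variable [Fintype V]

open scoped Classical in
/-- The vertices in the same branch as some member of `X`. -/
noncomputable def touched (T : ParentTree V) (X : Finset V) : Finset V :=
  (X.filter (fun a => a ≠ T.root)).biUnion (fun a => T.below (T.branch a))

theorem mem_touched {X : Finset V} {w : V} :
    w ∈ T.touched X ↔ ∃ a ∈ X, a ≠ T.root ∧ T.Desc (T.branch a) w := by
  simp [touched, mem_below, and_assoc]

theorem card_touched_le {t : ℕ} (ht : ∀ b, T.depth b = 1 → (T.below b).card ≤ t)
    (X : Finset V) : (T.touched X).card ≤ X.card * t := by
  classical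
  refine le_trans (Finset.card_biUnion_le_card_mul _ _ t fun a ha => ?_)
    (Nat.mul_le_mul_right _ (Finset.card_filter_le _ _))
  exact ht _ (T.depth_branch (Finset.mem_filter.1 ha).2)

theorem root_notMem_touched {X : Finset V} : T.root ∉ T.touched X := by
  rw [mem_touched]
  rintro ⟨a, -, ha, h⟩
  have := h.depth_le
  rw [T.depth_branch ha, T.depth_root] at this
  omega

theorem mem_touched_of_mem {X : Finset V} {a w : V} (ha : a ∈ X) (hr : a ≠ T.root)
    (h : T.Desc a w) : w ∈ T.touched X :=
  mem_touched.2 ⟨a, ha, hr, (T.desc_branch a).trans h⟩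

/-- Touchedness is constant along tree edges that avoid the root, so a potential defined separately
on touched and untouched branches has to be matched only at the root. -/
theorem parent_mem_touched {X : Finset V} {w : V} (h : T.parent w ≠ T.root) :
    T.parent w ∈ T.touched X ↔ w ∈ T.touched X := by
  simp only [mem_touched]
  refine exists_congr fun a => and_congr_right fun _ => and_congr_right fun ha => ?_
  refine ⟨fun hd => hd.trans (T.desc_parent w), fun hd => hd.parent_of_ne ?_⟩
  intro he
  have hw : w ≠ T.root := by
    rintro rfl
    exact h T.parent_root
  apply h
  rw [← T.depth_eq_zero]
  have h1 := T.depth_branch ha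
  have h2 := T.depth_parent w hw
  rw [he] at h2 ⊢
  omega

/-- No shortcut brings `v` nearer to the root. The potential measures depth capped at `depth v` on
the touched branches, is constant below `u`, and is minus the depth on the untouched branches. It
takes the value `depth v` at every new neighbor outside the part below `u`, so the new edges are
harmless, and its increment from `w` to `v` is the length of the path through the root. -/
theorem dist_le_dist_change_of_shallow (hconn : (neighborhoodChange T.graph u R A).Connected)
    {X : Finset V} (hX : ∀ x, x ∈ X ↔ x = u ∨ (x ∈ A ∧ ¬ T.Desc u x))
    {v : V} (hvu : ¬ T.Desc u v) (hmin : ∀ a ∈ A, ¬ T.Desc u a → T.depth v ≤ T.depth a)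
    (hvA : v ∈ A) (hor : T.parent u ∈ R ∨ T.depth v ≤ T.depth u + 1)
    {w : V} (hw : w ∉ T.touched X) :
    T.graph.dist v w ≤ (neighborhoodChange T.graph u R A).dist v w := by
  classical
  have hu : u ≠ T.root := by
    rintro rfl
    exact hvu (T.desc_root v)
  have huX : u ∈ X := (hX u).2 (Or.inl rfl)
  -- If the parent edge is gone, the part below `u` may take the value of its new neighbors.
  -- Otherwise it must also fit the parent of `u`, and then `depth v ≤ depth u + 1` keeps the new
  -- edges within one.
  set s : ℤ := if T.parent u ∈ R then (T.depth v : ℤ) else min (T.depth u : ℤ) (T.depth v) with hs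
  set f : V → ℤ := fun x => if T.Desc u x then s else
    if x = T.root ∨ x ∈ T.touched X then min (T.depth x : ℤ) (T.depth v) else -(T.depth x : ℤ)
    with hfdef
  have key := sub_le_dist_change hconn f (fun x hx h1 h2 => by
      have hdep := T.depth_parent x hx
      by_cases hd : T.Desc u x
      · by_cases hxu : x = u
        · subst hxu
          have hp : T.parent x ∉ R := fun h => h2 ⟨rfl, h⟩
          have hnd := not_desc_of_parent_eq hx rfl
          have ht : T.parent x = T.root ∨ T.parent x ∈ T.touched X := by
            by_cases hr : T.parent x = T.root
            · exact Or.inl hr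
            · exact Or.inr ((parent_mem_touched hr).2 (mem_touched_of_mem huX hx (Desc.refl T x)))
          simp only [hfdef, hd, hnd, ht, hs, hp, if_true, if_false]
          rw [abs_le]
          omega
        · simp [hfdef, hd, hd.parent_of_ne hxu]
      · have hnd : ¬ T.Desc u (T.parent x) := not_desc_parent hd
        by_cases hr : T.parent x = T.root
        · have h0 : T.depth (T.parent x) = 0 := T.depth_eq_zero.2 hr
          rw [hr] at hnd
          simp only [hfdef, hd, hnd, if_false, hr, true_or, if_true, T.depth_root]
          rw [abs_le]
          split_ifs <;> omega
        · simp only [hfdef, hd, hnd, if_false, hr, hx, false_or, parent_mem_touched hr]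
          rw [abs_le]
          split_ifs <;> omega)
    (fun a ha => by
      by_cases hd : T.Desc u a
      · simp [hfdef, hd, Desc.refl T u]
      · have hta : a = T.root ∨ a ∈ T.touched X := by
          by_cases hr : a = T.root
          · exact Or.inl hr
          · exact Or.inr (mem_touched_of_mem ((hX a).2 (Or.inr ⟨ha, hd⟩)) hr (Desc.refl T a))
        have hm := hmin a ha hd
        simp only [hfdef, hd, hta, Desc.refl T u, if_true, if_false, hs]
        rw [abs_le]
        split_ifs with hp
        · omega
        · have := hor.resolve_left hp
          omega) w v
  have hfv : f v = T.depth v := by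
    have : v = T.root ∨ v ∈ T.touched X := by
      by_cases hr : v = T.root
      · exact Or.inl hr
      · exact Or.inr (mem_touched_of_mem ((hX v).2 (Or.inr ⟨hvA, hvu⟩)) hr (Desc.refl T v))
    simp [hfdef, hvu, this]
  have hfw : f w = -(T.depth w : ℤ) := by
    have hnd : ¬ T.Desc u w := fun h => hw (mem_touched_of_mem huX hu h)
    by_cases hr : w = T.root
    · subst hr
      simp [hfdef, hnd, T.depth_root]
    · simp [hfdef, hnd, hr, hw]
  have h1 := T.dist_le_depth_add v w
  rw [hfv, hfw, SimpleGraph.dist_comm] at key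
  omega

/-- A path from `u` that enters a touched branch at depth at least `depth u + 2` is no nearer to the
root than `u` was. On touched branches the potential is therefore the remaining climb `depth u -
depth x`, truncated at 0, which vanishes at the new neighbors; on untouched ones it is the old
distance. -/
theorem dist_le_dist_change_of_deep (hconn : (neighborhoodChange T.graph u R A).Connected)
    {X : Finset V} (hX : ∀ a ∈ A, ¬ T.Desc u a → a ∈ X)
    (hdeep : ∀ a ∈ A, ¬ T.Desc u a → T.depth u + 2 ≤ T.depth a)
    {w : V} (hwu : ¬ T.Desc u w) (hw : w ∉ T.touched X) :
    T.graph.dist u w ≤ (neighborhoodChange T.graph u R A).dist u w := by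
  classical
  have key := sub_le_dist_change hconn (fun x => if T.Desc u x then 0 else
    if x ∈ T.touched X then max 0 ((T.depth u : ℤ) - T.depth x) else (T.graph.dist u x : ℤ))
    (fun x hx h1 h2 => by
      have hdep := T.depth_parent x hx
      have hadj := SimpleGraph.dist_eq_one_iff_adj.2 (T.adj_parent hx)
      by_cases hd : T.Desc u x
      · by_cases hxu : x = u
        · subst hxu
          have hnd := not_desc_of_parent_eq hx rfl
          simp only [hd, hnd, if_true, if_false]
          rw [abs_le]
          split_ifs <;> omega
        · simp [hd, hd.parent_of_ne hxu]
      · have hnd : ¬ T.Desc u (T.parent x) := not_desc_parent hd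
        have htri := abs_dist_sub_dist_le T.connected hadj.le u
        by_cases hr : T.parent x = T.root
        · have h0 : T.depth (T.parent x) = 0 := T.depth_eq_zero.2 hr
          have h3 := T.dist_of_desc (T.desc_root u)
          rw [T.depth_root, SimpleGraph.dist_comm] at h3
          have hu : T.depth u ≠ 0 := by
            rw [ne_eq, T.depth_eq_zero]
            rintro rfl
            exact hd (T.desc_root x)
          have hnt : T.parent x ∉ T.touched X := by
            rw [hr]
            exact root_notMem_touched
          simp only [hd, hnd, hnt, if_false]
          split_ifs
          · rw [hr, abs_le]
            omega
          · exact htri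
        · simp only [hd, hnd, if_false, parent_mem_touched hr]
          split_ifs
          · rw [abs_le]
            omega
          · exact htri)
    (fun a ha => by
      by_cases hd : T.Desc u a
      · simp [hd, Desc.refl T u]
      · have hdp := hdeep a ha hd
        have har : a ≠ T.root := by
          rintro rfl
          rw [T.depth_root] at hdp
          omega
        have hta := mem_touched_of_mem (hX a ha hd) har (Desc.refl T a)
        simp only [hd, hta, Desc.refl T u, if_true, if_false]
        rw [abs_le]
        omega) u w
  simp only [Desc.refl T u, hwu, hw, if_true, if_false, sub_zero] at key
  exact_mod_cast key

end Touched

end ParentTree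

/-! ### Counting edges and gains: no move improves all agents involved -/

namespace ParentTree

theorem dist_le_two_mul {V : Type*} {T : ParentTree V} {D : ℕ} (hD : ∀ x, T.depth x ≤ D) (x y : V) :
    (T.graph.dist x y : ℝ) ≤ 2 * D := by
  have h1 := T.dist_le_depth_add x y
  have h2 := hD x
  have h3 := hD y
  have : T.graph.dist x y ≤ 2 * D := by omega
  exact_mod_cast this

theorem sum_dist_sub_le {V : Type*} {T : ParentTree V} {D : ℕ} (hD : ∀ x, T.depth x ≤ D) (G' : SimpleGraph V) (x : V)
    {S X : Finset V} (h : ∀ w ∈ S, w ∉ X → T.graph.dist x w ≤ G'.dist x w) :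
    ∑ w ∈ S, ((T.graph.dist x w : ℝ) - G'.dist x w) ≤ 2 * D * X.card := by
  classical
  calc ∑ w ∈ S, ((T.graph.dist x w : ℝ) - G'.dist x w)
      ≤ ∑ w ∈ S, (if w ∈ X then (2 * D : ℝ) else 0) := by
        refine Finset.sum_le_sum fun w hw => ?_
        split_ifs with hX
        · have h1 := dist_le_two_mul hD x w
          have h2 : (0 : ℝ) ≤ G'.dist x w := Nat.cast_nonneg _
          linarith
        · have : (T.graph.dist x w : ℝ) ≤ G'.dist x w := by exact_mod_cast h w hw hX
          linarith
    _ = 2 * D * (S.filter (· ∈ X)).card := by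
        rw [← Finset.sum_filter, Finset.sum_const, nsmul_eq_mul, mul_comm]
    _ ≤ 2 * D * X.card := by
        gcongr
        intro w hw
        exact (Finset.mem_filter.1 hw).2

variable {V : Type*} [Fintype V] {T : ParentTree V}

section Counting

open scoped Classical

variable {u : V} (R A : Finset V)

theorem card_filter_desc (z : V) :
    ((A.filter (fun a => T.Desc z a)).card : ℝ) =
      ∑ x ∈ T.below z, if x ∈ A then (1 : ℝ) else 0 := by
  rw [Finset.sum_boole]
  congr 2
  ext x
  simp [mem_below, and_comm]

theorem card_eq_add_sum_children (hu : u ∉ A) :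
    (A.card : ℝ) = (A.filter (fun a => ¬ T.Desc u a)).card +
      ∑ c ∈ T.children u, ((A.filter (fun a => T.Desc c a)).card : ℝ) := by
  rw [← Finset.card_filter_add_card_filter_not (s := A) (fun a => T.Desc u a), Nat.cast_add,
    card_filter_desc, sum_below, if_neg hu]
  simp only [card_filter_desc]
  ring

theorem card_eq_add_sum_ite :
    (R.card : ℝ) = (R.filter (fun c => c ∉ T.children u)).card +
      ∑ c ∈ T.children u, if c ∈ R then (1 : ℝ) else 0 := by
  rw [← Finset.card_filter_add_card_filter_not (s := R) (fun c => c ∈ T.children u), Nat.cast_add,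
    Finset.sum_boole, add_comm]
  congr 3
  ext x
  simp [and_comm]

/-- For an agent `u` who removes her edges to `R` and adds edges to `A`, the number of additional
edges into the part below her child `c`. -/
noncomputable def surplus (T : ParentTree V) (R A : Finset V) (c : V) : ℝ :=
  (A.filter (fun a => T.Desc c a)).card - (if c ∈ R then 1 else 0)

variable {R A}

/-- A removed child must be replaced by a new neighbor below it, as the graph stays connected. -/
theorem surplus_nonneg (hconn : (neighborhoodChange T.graph u R A).Connected) {c : V}
    (hc : c ∈ T.children u) : 0 ≤ T.surplus R A c := by
  rw [mem_children] at hc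
  rw [surplus, sub_nonneg]
  split_ifs with hR
  · obtain ⟨a, ha, hca⟩ := exists_mem_desc_of_removed hconn hc.1 hc.2 (by exact_mod_cast hR)
    have : 0 < (A.filter (fun a => T.Desc c a)).card :=
      Finset.card_pos.2 ⟨a, Finset.mem_filter.2 ⟨by exact_mod_cast ha, hca⟩⟩
    exact_mod_cast this
  · positivity

/-- A positive surplus pays for the crude bound `2 * D` per vertex. With surplus 0, a kept child has
no new neighbor below it and yields no gain, while a removed one has exactly one replacement `v`. By
`hswap` this exchange is either useless or moves the entrance down by at most `H`, which saves at
most `H` per vertex. -/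
theorem gain_below_child {D t H : ℕ} (hD : ∀ x, T.depth x ≤ D)
    (ht : ∀ b, T.depth b = 1 → (T.below b).card ≤ t)
    (hswap : ∀ c v, c ≠ T.root → T.Desc c v →
      ∑ x ∈ T.below c, ((T.graph.dist (T.parent c) x : ℝ) - 1 - T.graph.dist v x) ≤ 0 ∨
        T.depth v ≤ T.depth c + H)
    (hconn : (neighborhoodChange T.graph u R A).Connected) {c : V} (hc : c ∈ T.children u) :
    ∑ x ∈ T.below c, ((T.graph.dist u x : ℝ) - (neighborhoodChange T.graph u R A).dist u x) ≤
        2 * t * D * T.surplus R A c ∨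
      (c ∈ R ∧ ∃ v ∈ A, T.Desc c v ∧ (∀ a ∈ A, T.Desc c a → a = v) ∧
        T.depth v ≤ T.depth c + H ∧
        ∑ x ∈ T.below c,
          ((T.graph.dist u x : ℝ) - (neighborhoodChange T.graph u R A).dist u x) ≤
          H * (T.below c).card) := by
  set G' := neighborhoodChange T.graph u R A with hG'
  obtain ⟨hcr, hcu⟩ := mem_children.1 hc
  have hs0 := surplus_nonneg hconn hc
  by_cases h1 : 1 ≤ T.surplus R A c
  · left
    have h2 := sum_dist_sub_le hD G' u (S := T.below c) (X := T.below c)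
      (fun w h h' => absurd h h')
    have h3 : ((T.below c).card : ℝ) ≤ t := by exact_mod_cast card_below_le ht hcr
    calc _ ≤ 2 * (D : ℝ) * (T.below c).card := h2
      _ ≤ 2 * D * t := by gcongr
      _ = 2 * t * D * 1 := by ring
      _ ≤ _ := by gcongr
  · by_cases hcR : c ∈ R
    · have hcard : (A.filter (fun a => T.Desc c a)).card = 1 := by
        rw [surplus, if_pos hcR] at h1 hs0
        have e1 : ((A.filter (fun a => T.Desc c a)).card : ℝ) < 2 := by linarith
        have e2 : (1 : ℝ) ≤ (A.filter (fun a => T.Desc c a)).card := by linarith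
        have e1' : (A.filter (fun a => T.Desc c a)).card < 2 := by exact_mod_cast e1
        have e2' : 1 ≤ (A.filter (fun a => T.Desc c a)).card := by exact_mod_cast e2
        omega
      obtain ⟨v, hv⟩ := Finset.card_eq_one.1 hcard
      have hv1 : v ∈ A ∧ T.Desc c v := by
        have : v ∈ A.filter (fun a => T.Desc c a) := by rw [hv]; simp
        simpa using this
      have hv2 : ∀ a ∈ A, T.Desc c a → a = v := by
        intro a ha hca
        have : a ∈ A.filter (fun a => T.Desc c a) := by simp [ha, hca]
        rw [hv] at this
        simpa using this
      have hle : ∀ x ∈ T.below c, (T.graph.dist u x : ℝ) - G'.dist u x ≤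
          (T.graph.dist (T.parent c) x : ℝ) - 1 - T.graph.dist v x := by
        intro x hx
        have : T.graph.dist v x + 1 ≤ G'.dist u x :=
          succ_dist_le_dist_change_of_swap hconn hcr hcu (by exact_mod_cast hcR) hv1.2
            (fun a ha => hv2 a (by exact_mod_cast ha)) (mem_below.1 hx)
        have : (T.graph.dist v x : ℝ) + 1 ≤ G'.dist u x := by exact_mod_cast this
        rw [hcu]
        linarith
      rcases hswap c v hcr hv1.2 with h | h
      · left
        refine le_trans (Finset.sum_le_sum hle) (h.trans ?_)
        positivity
      · right
        refine ⟨hcR, v, hv1.1, hv1.2, hv2, h, ?_⟩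
        refine (Finset.sum_le_sum hle).trans ?_
        rw [mul_comm, ← nsmul_eq_mul]
        refine Finset.sum_le_card_nsmul _ _ _ fun x _ => ?_
        have e1 := T.dist_of_desc ((T.desc_parent c).trans hv1.2)
        have e2 := T.connected.dist_triangle (u := T.parent c) (v := v) (w := x)
        have e3 := T.depth_parent c hcr
        have e4 : T.graph.dist (T.parent c) x ≤ H + 1 + T.graph.dist v x := by omega
        have : (T.graph.dist (T.parent c) x : ℝ) ≤ H + 1 + T.graph.dist v x := by
          exact_mod_cast e4
        linarith
    · left
      have hcard : (A.filter (fun a => T.Desc c a)).card = 0 := by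
        rw [surplus, if_neg hcR, sub_zero] at h1
        have : (A.filter (fun a => T.Desc c a)).card < 1 := by exact_mod_cast not_le.1 h1
        omega
      rw [Finset.card_eq_zero] at hcard
      refine le_trans (Finset.sum_nonpos fun x hx => ?_) (by positivity)
      have : T.graph.dist u x ≤ G'.dist u x :=
        dist_le_dist_change_of_untouched hconn hcr hcu (fun a ha hca => by
          have : a ∈ A.filter (fun a => T.Desc c a) := by
            rw [Finset.mem_filter]
            exact ⟨by exact_mod_cast ha, hca⟩
          rw [hcard] at this
          simp at this) (mem_below.1 hx)
      have : (T.graph.dist u x : ℝ) ≤ G'.dist u x := by exact_mod_cast this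
      linarith

/-- Inside the part below `c` the exchange gives `v` nothing. Outside, `v` travels through `u`; her
way to `u` shrinks from at most `H + 1` to 1, and beyond that she shares the gain of `u`. -/
theorem sum_dist_sub_le_of_swap {H : ℕ}
    (hconn : (neighborhoodChange T.graph u R A).Connected) {c v : V} (hcr : c ≠ T.root)
    (hcu : T.parent c = u) (hcR : c ∈ (R : Set V)) (hcv : T.Desc c v)
    (hvuniq : ∀ a ∈ (A : Set V), T.Desc c a → a = v) (hdep : T.depth v ≤ T.depth c + H) :
    ∑ x, ((T.graph.dist v x : ℝ) - (neighborhoodChange T.graph u R A).dist v x) ≤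
      H * (Fintype.card V : ℝ) + ∑ x ∈ Finset.univ.filter (fun x => ¬ T.Desc c x),
        ((T.graph.dist u x : ℝ) - (neighborhoodChange T.graph u R A).dist u x) := by
  set G' := neighborhoodChange T.graph u R A with hG'
  rw [← Finset.sum_filter_add_sum_filter_not Finset.univ (fun x => T.Desc c x)]
  have e1 : ∑ x ∈ Finset.univ.filter (fun x => T.Desc c x),
      ((T.graph.dist v x : ℝ) - G'.dist v x) ≤ 0 := by
    refine Finset.sum_nonpos fun x hx => ?_
    have : T.graph.dist v x ≤ G'.dist v x := dist_le_dist_change_of_swap hconn hcr hcu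
      hcR hcv hvuniq (Finset.mem_filter.1 hx).2
    have : (T.graph.dist v x : ℝ) ≤ G'.dist v x := by exact_mod_cast this
    linarith
  have e2 : ∑ x ∈ Finset.univ.filter (fun x => ¬ T.Desc c x),
      ((T.graph.dist v x : ℝ) - G'.dist v x) ≤
      ∑ x ∈ Finset.univ.filter (fun x => ¬ T.Desc c x),
        ((H : ℝ) + ((T.graph.dist u x : ℝ) - G'.dist u x)) := by
    refine Finset.sum_le_sum fun x hx => ?_
    have h1 : G'.dist u x + 1 ≤ G'.dist v x := succ_dist_change_le_of_swap hconn hcr hcu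
      hcR hcv hvuniq (Finset.mem_filter.1 hx).2
    have h2 := T.connected.dist_triangle (u := v) (v := u) (w := x)
    have h3 := T.dist_of_desc ((T.desc_parent c).trans hcv)
    rw [hcu, SimpleGraph.dist_comm] at h3
    have h4 := T.depth_parent c hcr
    rw [hcu] at h4
    have h5 : T.graph.dist v x + G'.dist u x ≤ H + T.graph.dist u x + G'.dist v x := by omega
    have : (T.graph.dist v x : ℝ) + G'.dist u x ≤ H + T.graph.dist u x + G'.dist v x := by
      exact_mod_cast h5
    linarith
  rw [Finset.sum_add_distrib, Finset.sum_const, nsmul_eq_mul] at e2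
  have e3 : ((Finset.univ.filter (fun x => ¬ T.Desc c x)).card : ℝ) * H ≤
      (Fintype.card V : ℝ) * H := by
    gcongr
    exact Finset.card_le_univ _
  linarith

set_option maxHeartbeats 800000 in
/-- No agent and her new neighbors can all gain more than the price of their new edges. -/
theorem not_improving {α : ℝ} {D t H : ℕ} (hα : 0 < α) (hD : ∀ x, T.depth x ≤ D)
    (ht : ∀ b, T.depth b = 1 → (T.below b).card ≤ t)
    (hswap : ∀ c v, c ≠ T.root → T.Desc c v →
      ∑ x ∈ T.below c, ((T.graph.dist (T.parent c) x : ℝ) - 1 - T.graph.dist v x) ≤ 0 ∨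
        T.depth v ≤ T.depth c + H)
    (hlt : 2 * H * (Fintype.card V : ℝ) + (2 + 2 * D * Fintype.card V / α) * (2 * t * D) < α)
    (hR : ∀ v ∈ R, T.graph.Adj u v) (hA : ∀ v ∈ A, v ≠ u ∧ ¬ T.graph.Adj u v)
    (hconn : (neighborhoodChange T.graph u R A).Connected)
    (hu : α * ((A.card : ℝ) - R.card) <
      ∑ x, ((T.graph.dist u x : ℝ) - (neighborhoodChange T.graph u R A).dist u x))
    (hv : ∀ v ∈ A, α <
      ∑ x, ((T.graph.dist v x : ℝ) - (neighborhoodChange T.graph u R A).dist v x)) : False := by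
  set G' := neighborhoodChange T.graph u R A with hG'
  set n : ℝ := (Fintype.card V : ℝ) with hn
  set B : ℝ := 2 * t * D with hB
  have hn0 : 0 ≤ n := Nat.cast_nonneg _
  have hB0 : 0 ≤ B := by positivity
  have hq0 : 0 ≤ 2 * D * n / α := by positivity
  have hBα : B ≤ α := by nlinarith [mul_nonneg hq0 hB0, mul_nonneg (Nat.cast_nonneg (α := ℝ) H) hn0]
  have huA : u ∉ A := fun h => (hA u h).1 rfl
  set Aout := A.filter (fun a => ¬ T.Desc u a) with hAout
  set N : ℝ := (A.card : ℝ) - R.card with hN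
  -- No distance exceeds `2 * D`, so `u` gains at most `2 * D * n` in total, which limits her net
  -- number of new edges.
  have hNlt : N < 2 * D * n / α := by
    rw [lt_div_iff₀ hα, mul_comm N]
    refine hu.trans_le ?_
    have := sum_dist_sub_le hD G' u (S := Finset.univ) (X := Finset.univ) (fun w h h' => absurd h h')
    simpa [hn] using this
  have hcardN : N = Aout.card - (R.filter (fun c => c ∉ T.children u)).card +
      ∑ c ∈ T.children u, T.surplus R A c := by
    rw [hN, card_eq_add_sum_children A huA, card_eq_add_sum_ite R (u := u) (T := T)]
    simp only [surplus, Finset.sum_sub_distrib]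
    ring
  have hsur : 0 ≤ ∑ c ∈ T.children u, T.surplus R A c :=
    Finset.sum_nonneg fun c hc => surplus_nonneg hconn hc
  have hRpar : ∀ v ∈ R, v ∉ T.children u → u ≠ T.root ∧ v = T.parent u := by
    intro v hvR hvc
    rcases T.adj_iff.1 (hR v hvR) with ⟨h1, h2⟩ | h
    · exact ⟨h1, h2.symm⟩
    · exact absurd (mem_children.2 h) hvc
  by_cases hcase : (u ≠ T.root ∧ T.parent u ∈ R) ∨
      ∃ a ∈ A, ¬ T.Desc u a ∧ T.depth a ≤ T.depth u + 1
  · -- the shallowest new neighbor outside the part below `u` does not gain enough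
    have hne : Aout.Nonempty := by
      rcases hcase with ⟨h1, h2⟩ | ⟨a, ha, hua, -⟩
      · obtain ⟨a, ha, hua⟩ := exists_mem_not_desc_of_removed hconn h1 (by exact_mod_cast h2)
        exact ⟨a, Finset.mem_filter.2 ⟨by exact_mod_cast ha, hua⟩⟩
      · exact ⟨a, Finset.mem_filter.2 ⟨ha, hua⟩⟩
    obtain ⟨v, hvm, hmin⟩ := Finset.exists_min_image Aout T.depth hne
    obtain ⟨hvA, hvu⟩ := Finset.mem_filter.1 hvm
    have hor : T.parent u ∈ R ∨ T.depth v ≤ T.depth u + 1 := by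
      rcases hcase with h | ⟨a, ha, hua, hle⟩
      · exact Or.inl h.2
      · exact Or.inr ((hmin a (Finset.mem_filter.2 ⟨ha, hua⟩)).trans hle)
    have hgain := sum_dist_sub_le hD G' v (S := Finset.univ) (X := T.touched (insert u Aout))
      (fun w _ hw => dist_le_dist_change_of_shallow hconn
        (by intro x; simp [hAout]) hvu
        (fun a ha hua => hmin a (Finset.mem_filter.2 ⟨by exact_mod_cast ha, hua⟩))
        (by exact_mod_cast hvA) (by simpa using hor) hw)
    have hc1 : ((T.touched (insert u Aout)).card : ℝ) ≤ (Aout.card + 1) * t := by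
      have h1 := card_touched_le ht (insert u Aout)
      have h2 : (insert u Aout).card * t ≤ (Aout.card + 1) * t :=
        Nat.mul_le_mul_right _ (Finset.card_insert_le _ _)
      exact_mod_cast h1.trans h2
    have hc2 : (R.filter (fun c => c ∉ T.children u)).card ≤ 1 := by
      rw [Finset.card_le_one]
      intro a ha b hb
      rw [Finset.mem_filter] at ha hb
      rw [(hRpar a ha.1 ha.2).2, (hRpar b hb.1 hb.2).2]
    have hc2' : ((R.filter (fun c => c ∉ T.children u)).card : ℝ) ≤ 1 := by exact_mod_cast hc2
    -- Of the 2, one stands for the branch of `u` itself, the other for her possibly removed parent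
    -- edge.
    have hc3 : (Aout.card : ℝ) + 1 ≤ 2 + 2 * D * n / α := by linarith
    have := hv v hvA
    have h5 : 2 * (D : ℝ) * (T.touched (insert u Aout)).card ≤ (2 + 2 * D * n / α) * B :=
      calc 2 * (D : ℝ) * (T.touched (insert u Aout)).card
          ≤ 2 * D * ((Aout.card + 1) * t) := by gcongr
        _ = (Aout.card + 1) * B := by rw [hB]; ring
        _ ≤ _ := by gcongr
    have : 0 ≤ 2 * (H : ℝ) * n := by positivity
    linarith
  -- Now `u` keeps her parent, if any, and each of her net new edges is charged at most `B ≤ α`,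
  -- exchanged children excepted.
  · push Not at hcase
    obtain ⟨hpar, hdeep⟩ := hcase
    have hR0 : R.filter (fun c => c ∉ T.children u) = ∅ := by
      rw [Finset.filter_eq_empty_iff]
      intro v hvR hvc
      obtain ⟨h1, rfl⟩ := hRpar v hvR hvc
      exact hpar h1 hvR
    rw [hR0, Finset.card_empty, Nat.cast_zero, sub_zero] at hcardN
    set g : V → ℝ := fun x => (T.graph.dist u x : ℝ) - G'.dist u x with hg
    have hgsum : ∑ x, g x = ∑ x ∈ Finset.univ.filter (fun x => ¬ T.Desc u x), g x +
        ∑ c ∈ T.children u, ∑ x ∈ T.below c, g x := by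
      rw [← Finset.sum_filter_add_sum_filter_not Finset.univ (fun x => T.Desc u x)]
      have h1 : ∑ x ∈ Finset.univ.filter (fun x => T.Desc u x), g x = ∑ x ∈ T.below u, g x := rfl
      rw [h1, sum_below]
      have : g u = 0 := by simp [hg]
      rw [this]
      ring
    have hup : ∑ x ∈ Finset.univ.filter (fun x => ¬ T.Desc u x), g x ≤ B * Aout.card := by
      have h1 := sum_dist_sub_le hD G' u (S := Finset.univ.filter (fun x => ¬ T.Desc u x))
        (X := T.touched Aout) (fun w hw hwX => dist_le_dist_change_of_deep hconn
          (fun a ha hua => Finset.mem_filter.2 ⟨by exact_mod_cast ha, hua⟩)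
          (fun a ha hua => hdeep a (by exact_mod_cast ha) hua) (Finset.mem_filter.1 hw).2 hwX)
      have h2 : ((T.touched Aout).card : ℝ) ≤ Aout.card * t := by
        exact_mod_cast card_touched_le ht Aout
      calc _ ≤ 2 * (D : ℝ) * (T.touched Aout).card := h1
        _ ≤ 2 * D * (Aout.card * t) := by gcongr
        _ = _ := by rw [hB]; ring
    have hchild := fun c hc => gain_below_child (R := R) (A := A) hD ht hswap hconn (u := u) (c := c) hc
    have hN0 : 0 ≤ N := by rw [hcardN]; positivity
    by_cases hall : ∀ c ∈ T.children u, ∑ x ∈ T.below c, g x ≤ B * T.surplus R A c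
    · have h1 : ∑ x, g x ≤ B * N := by
        rw [hgsum, hcardN, mul_add, Finset.mul_sum]
        exact add_le_add hup (Finset.sum_le_sum hall)
      have h2 : B * N ≤ α * N := by gcongr
      linarith
    -- Some child is exchanged for `v`. The agent who refuses is now `v`: `u` gains at most `H * n +
    -- B * N` outside the part below `c`, so `v` gains at most `2 * H * n + B * N < α`.
    · push Not at hall
      obtain ⟨c, hc, hclt⟩ := hall
      obtain ⟨hcR, v, hvA, hcv, hvuniq, hdep, -⟩ := (hchild c hc).resolve_left (not_le.2 hclt)
      obtain ⟨hcr, hcu⟩ := mem_children.1 hc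
      have hcR' : c ∈ (R : Set V) := by exact_mod_cast hcR
      have hvuniq' : ∀ a ∈ (A : Set V), T.Desc c a → a = v := fun a ha =>
        hvuniq a (by exact_mod_cast ha)
      have hother : ∀ c' ∈ T.children u,
          ∑ x ∈ T.below c', g x ≤ H * (T.below c').card + B * T.surplus R A c' := by
        intro c' hc'
        have h0 := surplus_nonneg hconn hc'
        have e1 : 0 ≤ B * T.surplus R A c' := by positivity
        have e2 : (0 : ℝ) ≤ H * (T.below c').card := by positivity
        rcases hchild c' hc' with h | ⟨-, _, _, _, _, _, h⟩
        · exact h.trans (by linarith)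
        · exact h.trans (by linarith)
      have hout : ∑ x ∈ Finset.univ.filter (fun x => ¬ T.Desc c x), g x ≤ H * n + B * N := by
        have e1 : ∑ x ∈ Finset.univ.filter (fun x => ¬ T.Desc c x), g x =
            ∑ x, g x - ∑ x ∈ T.below c, g x := by
          rw [← Finset.sum_filter_add_sum_filter_not Finset.univ (fun x => T.Desc c x)]
          have h1 : ∑ x ∈ Finset.univ.filter (fun x => T.Desc c x), g x =
            ∑ x ∈ T.below c, g x := rfl
          rw [h1]
          ring
        have e2 : ∑ c' ∈ (T.children u).erase c, ∑ x ∈ T.below c', g x =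
            ∑ c' ∈ T.children u, ∑ x ∈ T.below c', g x - ∑ x ∈ T.below c, g x :=
          Finset.sum_erase_eq_sub hc
        have e3 : ∑ c' ∈ (T.children u).erase c, ∑ x ∈ T.below c', g x ≤
            ∑ c' ∈ T.children u, (H * ((T.below c').card : ℝ) + B * T.surplus R A c') := by
          refine (Finset.sum_le_sum fun c' hc' => hother c' (Finset.mem_of_mem_erase hc')).trans ?_
          refine Finset.sum_le_sum_of_subset_of_nonneg (Finset.erase_subset _ _) ?_
          intro c' hc' _
          have := surplus_nonneg hconn hc'
          positivity
        have e4 : ∑ c' ∈ T.children u, ((T.below c').card : ℝ) ≤ n := by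
          have h1 := sum_below (T := T) u (fun _ => (1 : ℝ))
          simp only [Finset.sum_const, nsmul_eq_mul, mul_one] at h1
          have h2 : ((T.below u).card : ℝ) ≤ n := by
            exact Nat.cast_le.2 (Finset.card_le_univ _)
          linarith
        rw [Finset.sum_add_distrib, ← Finset.mul_sum, ← Finset.mul_sum] at e3
        have e5 : (H : ℝ) * ∑ c' ∈ T.children u, ((T.below c').card : ℝ) ≤ H * n := by gcongr
        rw [e1, hgsum, hcardN]
        linarith
      have hvgain := sum_dist_sub_le_of_swap hconn hcr hcu hcR' hcv hvuniq' hdep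
      have h1 := hv v hvA
      have h2 : B * N ≤ B * (2 * D * n / α) := by gcongr
      nlinarith

end Counting

end ParentTree

/-! ### From costs to distance sums -/

theorem agentCost_of_connected {V : Type*} [Fintype V] {G : SimpleGraph V} (hG : G.Connected)
    (α : ℝ) (M : ℕ) (u : V) :
    agentCost α M G u = α * ((G.neighborSet u).ncard : ℝ) + ∑ v : V, (G.dist u v : ℝ) := by
  simp [agentCost, agentDist, hG.preconnected u]

theorem agentDist_nonneg {V : Type*} (M : ℕ) (G : SimpleGraph V) (u v : V) :
    0 ≤ agentDist M G u v := by
  rw [agentDist]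
  split_ifs <;> positivity

theorem le_agentCost_of_not_reachable {V : Type*} [Fintype V] {G : SimpleGraph V} {α : ℝ}
    (hα : 0 ≤ α) {M : ℕ} {u v : V} (h : ¬ G.Reachable u v) : (M : ℝ) ≤ agentCost α M G u := by
  have h1 : agentDist M G u v ≤ ∑ v : V, agentDist M G u v :=
    Finset.single_le_sum (fun w _ => agentDist_nonneg M G u w) (Finset.mem_univ v)
  rw [agentDist, if_neg h] at h1
  rw [agentCost]
  have : 0 ≤ α * ((G.neighborSet u).ncard : ℝ) := by positivity
  linarith

theorem agentCost_le_of_connected {V : Type*} [Fintype V] {G : SimpleGraph V} (hG : G.Connected)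
    {α : ℝ} (hα : 1 ≤ α) (M : ℕ) (u : V) (hV : 2 ≤ Fintype.card V) :
    agentCost α M G u ≤ α * (Fintype.card V : ℝ) ^ 3 := by
  classical
  set n : ℝ := (Fintype.card V : ℝ) with hn
  have hn2 : (2 : ℝ) ≤ n := by rw [hn]; exact_mod_cast hV
  rw [agentCost_of_connected hG]
  have h1 : ((G.neighborSet u).ncard : ℝ) ≤ n := by
    rw [hn, ← Nat.card_eq_fintype_card]
    exact Nat.cast_le.2 (Set.ncard_le_card _)
  have h2 : ∑ v : V, (G.dist u v : ℝ) ≤ n * n := by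
    calc ∑ v : V, (G.dist u v : ℝ) ≤ ∑ v : V, n := by
          refine Finset.sum_le_sum fun v _ => ?_
          obtain ⟨p, hp, hl⟩ := hG.exists_path_of_dist u v
          rw [← hl, hn]
          exact Nat.cast_le.2 hp.length_lt.le
      _ = n * n := by simp [hn]
  have h3 : α * ((G.neighborSet u).ncard : ℝ) ≤ α * n := by gcongr
  have h4 : n * n ≤ α * (n * n) := by nlinarith
  have h5 : α * (n + n * n) ≤ α * n ^ 3 := by
    gcongr
    nlinarith [mul_nonneg (mul_nonneg (by linarith : (0:ℝ) ≤ n) (by linarith : 0 ≤ n - 2))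
      (by linarith : (0:ℝ) ≤ n + 1)]
  linarith

theorem ncard_neighborSet_neighborhoodChange {V : Type*} [Fintype V] {G : SimpleGraph V} {u : V}
    {R A : Finset V} (hR : ∀ v ∈ R, G.Adj u v) (hA : ∀ v ∈ A, v ≠ u ∧ ¬ G.Adj u v) :
    (((neighborhoodChange G u R A).neighborSet u).ncard : ℝ) =
      (G.neighborSet u).ncard + ((A.card : ℝ) - R.card) := by
  have h1 : (neighborhoodChange G u R A).neighborSet u = (G.neighborSet u \ R) ∪ A := by
    ext x
    simp only [SimpleGraph.mem_neighborSet, neighborhoodChange_adj, Set.mem_union, Set.mem_sdiff]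
    constructor
    · rintro (⟨h, h1, -⟩ | ⟨h, ⟨-, h1⟩ | ⟨h1, -⟩⟩)
      · exact Or.inl ⟨h, fun hx => h1 ⟨trivial, hx⟩⟩
      · exact Or.inr h1
      · exact absurd h1.symm h
    · rintro (⟨h, h1⟩ | h)
      · exact Or.inl ⟨h, fun h' => h1 h'.2, fun h' => h.ne h'.1.symm⟩
      · exact Or.inr ⟨(hA x (by exact_mod_cast h)).1.symm, Or.inl ⟨trivial, h⟩⟩
  have h2 : Disjoint (G.neighborSet u \ (R : Set V)) (A : Set V) := by
    rw [Set.disjoint_left]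
    intro x hx hxA
    exact (hA x (by exact_mod_cast hxA)).2 hx.1
  have h3 : (R : Set V) ⊆ G.neighborSet u := fun x hx => hR x (by exact_mod_cast hx)
  have h4 := Set.ncard_sdiff_add_ncard_of_subset h3
  rw [h1, Set.ncard_union_eq h2, Set.ncard_coe_finset]
  rw [Set.ncard_coe_finset] at h4
  have : ((G.neighborSet u \ (R : Set V)).ncard : ℝ) + R.card = (G.neighborSet u).ncard := by
    exact_mod_cast h4
  push_cast
  linarith

/-- A new neighbor of `u` is not in `R`, so she loses no edge and has to pay for one more. -/
theorem ncard_neighborSet_lt_neighborhoodChange {V : Type*} [Fintype V] {G : SimpleGraph V} {u : V}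
    {R A : Set V} (hR : ∀ v ∈ R, G.Adj u v) (hA : ∀ v ∈ A, v ≠ u ∧ ¬ G.Adj u v) {v : V}
    (hv : v ∈ A) :
    (G.neighborSet v).ncard + 1 ≤ ((neighborhoodChange G u R A).neighborSet v).ncard := by
  have hu : u ∉ G.neighborSet v := fun h => (hA v hv).2 (SimpleGraph.Adj.symm h)
  rw [← Set.ncard_insert_of_notMem hu]
  refine Set.ncard_le_ncard ?_
  intro x hx
  rw [SimpleGraph.mem_neighborSet, neighborhoodChange_adj]
  rcases hx with rfl | hx
  · exact Or.inr ⟨(hA v hv).1, Or.inr ⟨rfl, hv⟩⟩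
  · refine Or.inl ⟨hx, fun h => (hA v hv).1 h.1, fun h => (hA v hv).2 (hR v h.2)⟩

namespace ParentTree

theorem isBNE {V : Type*} [Fintype V] (T : ParentTree V) {α : ℝ} {M D t H : ℕ} (hα : 1 ≤ α)
    (hV : 2 ≤ Fintype.card V) (hM : α * (Fintype.card V : ℝ) ^ 3 < M)
    (hD : ∀ x, T.depth x ≤ D) (ht : ∀ b, T.depth b = 1 → (T.below b).card ≤ t)
    (hswap : ∀ c v, c ≠ T.root → T.Desc c v →
      ∑ x ∈ T.below c, ((T.graph.dist (T.parent c) x : ℝ) - 1 - T.graph.dist v x) ≤ 0 ∨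
        T.depth v ≤ T.depth c + H)
    (hlt : 2 * H * (Fintype.card V : ℝ) + (2 + 2 * D * Fintype.card V / α) * (2 * t * D) < α) :
    IsBNE α M T.graph := by
  rintro ⟨u, R, A, hR, hA, hu, hv⟩
  lift R to Finset V using R.toFinite
  lift A to Finset V using A.toFinite
  -- A disconnected outcome costs `u` at least `M`, more than any agent pays in a connected graph.
  have hconn : (neighborhoodChange T.graph u R A).Connected := by
    have : ∀ w, (neighborhoodChange T.graph u R A).Reachable u w := by
      intro w
      by_contra hw
      have h1 := le_agentCost_of_not_reachable (by linarith : 0 ≤ α) (M := M) hw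
      have h2 := agentCost_le_of_connected T.connected hα M u hV
      linarith
    exact { preconnected := fun x y => (this x).symm.trans (this y), nonempty := ⟨u⟩ }
  simp only [agentCost_of_connected T.connected, agentCost_of_connected hconn] at hu hv
  have hR' : ∀ v ∈ R, T.graph.Adj u v := fun v h => hR v (by exact_mod_cast h)
  have hA' : ∀ v ∈ A, v ≠ u ∧ ¬ T.graph.Adj u v := fun v h => hA v (by exact_mod_cast h)
  refine not_improving (by linarith : 0 < α) hD ht hswap hlt hR' hA' hconn ?_ ?_
  · rw [ncard_neighborSet_neighborhoodChange hR' hA'] at hu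
    rw [Finset.sum_sub_distrib]
    linarith
  · intro v hvA
    have h1 := hv v (by exact_mod_cast hvA)
    have h2 := ncard_neighborSet_lt_neighborhoodChange hR hA (v := v) (by exact_mod_cast hvA)
    have h3 : ((T.graph.neighborSet v).ncard : ℝ) + 1 ≤
        ((neighborhoodChange T.graph u R A).neighborSet v).ncard := by exact_mod_cast h2
    have h4 := mul_le_mul_of_nonneg_left h3 (by linarith : 0 ≤ α)
    rw [Finset.sum_sub_distrib]
    linarith

/-! ### Swapping a child for a deeper descendant -/

section Sizes

variable {V : Type*} [Fintype V] {T : ParentTree V}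

/-- One step down to `v` shortens by one the distances to the part below `v` and lengthens by one
those to everything else below `c`. -/
theorem sum_swap_le_parent {c v : V} (hc : c ≠ T.root) (hv : T.Desc c v) (hne : v ≠ c) :
    ∑ x ∈ T.below c, ((T.graph.dist (T.parent c) x : ℝ) - 1 - T.graph.dist v x) ≤
      ∑ x ∈ T.below c, ((T.graph.dist (T.parent c) x : ℝ) - 1 - T.graph.dist (T.parent v) x) +
        (2 * ((T.below v).card : ℝ) - (T.below c).card) := by
  classical
  have hvr : v ≠ T.root := hv.ne_root hc
  have hadj := T.adj_parent hvr
  have hd1 : T.graph.dist v (T.parent v) = 1 := SimpleGraph.dist_eq_one_iff_adj.2 hadj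
  have hp : ∀ x, T.graph.dist (T.parent v) x ≤ T.graph.dist v x + 1 := by
    intro x
    have := T.connected.dist_triangle (u := T.parent v) (v := v) (w := x)
    rw [SimpleGraph.dist_comm (u := T.parent v) (v := v)] at this
    omega
  have hout : ∀ x, ¬ T.Desc v x → T.graph.dist (T.parent v) x + 1 ≤ T.graph.dist v x := by
    intro x hx
    have hnp : ¬ T.Desc v (T.parent v) := by
      intro h
      have h1 := h.depth_le
      have h2 := T.depth_parent v hvr
      omega
    have := T.abs_sub_le_dist (fun y => if T.Desc v y then 0 else
      (T.graph.dist (T.parent v) y : ℤ) + 1) (fun y hy => by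
        by_cases hd : T.Desc v y
        · by_cases hyv : y = v
          · subst hyv
            simp [hd, hnp]
          · simp [hd, hd.parent_of_ne hyv]
        · simp only [hd, not_desc_parent hd, if_false, add_sub_add_right_eq_sub]
          exact abs_dist_sub_dist_le T.connected
            (SimpleGraph.dist_eq_one_iff_adj.2 (T.adj_parent hy)).le _) v x
    simp only [Desc.refl T v, hx, if_true, if_false, zero_sub, abs_neg] at this
    have := (abs_le.1 this).2
    omega
  have hcard : ((T.below v).card : ℝ) = ∑ x ∈ T.below c, if T.Desc v x then (1 : ℝ) else 0 := by
    rw [Finset.sum_boole]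
    congr 2
    ext x
    simp only [mem_below, Finset.mem_filter]
    exact ⟨fun h => ⟨hv.trans h, h⟩, fun h => h.2⟩
  have hcard' : ((T.below c).card : ℝ) = ∑ x ∈ T.below c, (1 : ℝ) := by simp
  rw [hcard, hcard', Finset.mul_sum, ← Finset.sum_sub_distrib, ← Finset.sum_add_distrib]
  refine Finset.sum_le_sum fun x _ => ?_
  split_ifs with hx
  · have : (T.graph.dist (T.parent v) x : ℝ) ≤ T.graph.dist v x + 1 := by exact_mod_cast hp x
    linarith
  · have : (T.graph.dist (T.parent v) x : ℝ) + 1 ≤ T.graph.dist v x := by exact_mod_cast hout x hx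
    linarith

/-- In a tree whose subtree sizes drop to a half after at most `q ≤ k - 1` steps below `c` and to a
quarter after another `k` steps, only descendants of `c` at distance at most `4 (k - 1)` can be
better neighbors than `c` itself. -/
theorem sum_swap_nonpos_or {k : ℕ} {c v : V} {q : ℕ} (hq : q + 1 ≤ k) (hc : c ≠ T.root)
    (hhalf : ∀ z, T.Desc c z → T.depth c + q < T.depth z →
      2 * (T.below z).card ≤ (T.below c).card)
    (hquarter : ∀ z, T.Desc c z → T.depth c + q + k < T.depth z →
      4 * (T.below z).card ≤ (T.below c).card)
    (hv : T.Desc c v) :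
    ∑ x ∈ T.below c, ((T.graph.dist (T.parent c) x : ℝ) - 1 - T.graph.dist v x) ≤ 0 ∨
      T.depth v ≤ T.depth c + 4 * (k - 1) := by
  set L : V → ℝ := fun v =>
    ∑ x ∈ T.below c, ((T.graph.dist (T.parent c) x : ℝ) - 1 - T.graph.dist v x) with hL
  set S : ℝ := ((T.below c).card : ℝ) with hS
  have hS0 : 0 ≤ S := Nat.cast_nonneg _
  -- Per step down, the benefit grows by at most `S` in the first `q` steps, does not grow in the
  -- next `k`, and falls by at least `S / 2` after that. It is used up at depth `3 * q + k ≤ 4 * (k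
  -- - 1) + 1`.
  have key : ∀ i : ℕ, ∀ v, T.Desc c v → T.depth v = T.depth c + i →
      2 * L v ≤ S * (2 * (min i q : ℕ) - (i - (q + k) : ℕ)) := by
    intro i
    induction i with
    | zero =>
      intro v hv hd
      have : c = v := hv.eq_of_depth (Desc.refl T v) (by omega)
      subst this
      have : L c = 0 := by
        refine Finset.sum_eq_zero fun x hx => ?_
        rw [mem_below] at hx
        have h1 := T.dist_of_desc hx
        have h2 := T.dist_of_desc ((T.desc_parent c).trans hx)
        have h3 := T.depth_parent c hc
        have h4 : T.graph.dist (T.parent c) x = 1 + T.graph.dist c x := by omega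
        rw [h4]
        push_cast
        ring
      simp [this]
    | succ i ih =>
      intro v hv hd
      have hne : v ≠ c := by
        rintro rfl
        omega
      have hvr := hv.ne_root hc
      have hdp := T.depth_parent v hvr
      have h1 := ih (T.parent v) (hv.parent_of_ne hne) (by omega)
      have h2 : L v ≤ L (T.parent v) + (2 * ((T.below v).card : ℝ) - S) :=
        sum_swap_le_parent hc hv hne
      by_cases hi : i + 1 ≤ q
      · have e1 : min (i + 1) q = min i q + 1 := by omega
        have e2 : i + 1 - (q + k) = i - (q + k) := by omega
        have e3 : ((T.below v).card : ℝ) ≤ S := by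
          refine Nat.cast_le.2 (Finset.card_le_card fun x hx => ?_)
          rw [mem_below] at hx ⊢
          exact hv.trans hx
        rw [e1, e2]
        push_cast at h1 ⊢
        linarith
      · have e1 : min (i + 1) q = min i q := by omega
        by_cases hi2 : i + 1 ≤ q + k
        · have e2 : i + 1 - (q + k) = i - (q + k) := by omega
          have e3 : 2 * ((T.below v).card : ℝ) ≤ S := by
            rw [hS]
            exact_mod_cast hhalf v hv (by omega)
          rw [e1, e2]
          linarith
        · have e2 : i + 1 - (q + k) = i - (q + k) + 1 := by omega
          have e3 : 4 * ((T.below v).card : ℝ) ≤ S := by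
            rw [hS]
            exact_mod_cast hquarter v hv (by omega)
          rw [e1, e2]
          push_cast at h1 ⊢
          linarith
  by_contra! hcon
  obtain ⟨h1, h2⟩ := hcon
  have h3 := hv.depth_le
  have h4 := key (T.depth v - T.depth c) v hv (by omega)
  have h5 : 2 * min (T.depth v - T.depth c) q ≤ T.depth v - T.depth c - (q + k) := by omega
  have h6 : 2 * ((min (T.depth v - T.depth c) q : ℕ) : ℝ) ≤
      (T.depth v - T.depth c - (q + k) : ℕ) := by exact_mod_cast h5
  have h7 := mul_nonneg hS0 (sub_nonneg.2 h6)
  linarith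

end Sizes

end ParentTree

namespace ParentTree

/-! ### Transport along an equivalence -/

/-- The same tree on other vertices. -/
def map {V W : Type*} (T : ParentTree V) (e : V ≃ W) : ParentTree W where
  root := e T.root
  parent w := e (T.parent (e.symm w))
  depth w := T.depth (e.symm w)
  parent_root := by simp [T.parent_root]
  depth_root := by simp [T.depth_root]
  depth_parent w hw := by
    have : e.symm w ≠ T.root := fun h => hw (by rw [← h, Equiv.apply_symm_apply])
    simpa using T.depth_parent _ this

theorem desc_map {V W : Type*} (T : ParentTree V) (e : V ≃ W) (z x : W) :
    (T.map e).Desc z x ↔ T.Desc (e.symm z) (e.symm x) := by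
  have h : ∀ i : ℕ, (T.map e).parent^[i] x = e (T.parent^[i] (e.symm x)) := by
    intro i
    induction i with
    | zero => simp
    | succ i ih =>
      rw [Function.iterate_succ_apply', ih, Function.iterate_succ_apply']
      simp [map]
  simp only [Desc, h, Equiv.eq_symm_apply]

theorem card_below_map {V W : Type*} [Fintype V] [Fintype W] (T : ParentTree V) (e : V ≃ W)
    (z : W) : ((T.map e).below z).card = (T.below (e.symm z)).card := by
  refine Finset.card_equiv e.symm fun x => ?_
  rw [mem_below, mem_below, desc_map]

end ParentTree

/-! ### Stretched binary trees -/

theorem Nat.log_two_half {h : ℕ} (hh : 2 ≤ h) : Nat.log 2 (h / 2) + 1 = Nat.log 2 h :=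
  (Nat.log_of_one_lt_of_le (by norm_num) hh).symm

/-- A root and `m` copies of the binary tree with nodes `1, …, 2 ^ d - 1`, where `h / 2` is the
parent of `h`, each of whose nodes is stretched to a path with `k + 1` vertices. -/
abbrev StretchedVertex (m d k : ℕ) : Type :=
  Option (Fin m × Finset.Ico 1 (2 ^ d) × Fin (k + 1))

namespace StretchedVertex

variable {m d k : ℕ}

/-- The parent of a vertex. -/
def parent : StretchedVertex m d k → StretchedVertex m d k
  | none => none
  | some (b, h, j) =>
    if hj : j.1 ≠ 0 then some (b, h, ⟨j.1 - 1, by omega⟩)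
    else if hh : 2 ≤ h.1 then
      some (b, ⟨h.1 / 2, by have := Finset.mem_Ico.1 h.2; rw [Finset.mem_Ico]; omega⟩, Fin.last k)
    else none

/-- The depth of a vertex. -/
def depth : StretchedVertex m d k → ℕ
  | none => 0
  | some (_, h, j) => (k + 1) * Nat.log 2 h.1 + j.1 + 1

theorem log_lt (h : Finset.Ico 1 (2 ^ d)) : Nat.log 2 h.1 < d := by
  have := Finset.mem_Ico.1 h.2
  exact Nat.log_lt_of_lt_pow (by omega) this.2

theorem depth_le (v : StretchedVertex m d k) : depth v ≤ (k + 1) * d := by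
  rcases v with _ | ⟨b, h, j⟩
  · exact Nat.zero_le _
  · have h1 : (k + 1) * (Nat.log 2 h.1 + 1) ≤ (k + 1) * d := Nat.mul_le_mul_left _ (log_lt h)
    have h2 := j.2
    simp only [depth]
    rw [Nat.mul_add] at h1
    omega

/-- The stretched tree. -/
def tree (m d k : ℕ) : ParentTree (StretchedVertex m d k) where
  root := none
  parent := parent
  depth := depth
  parent_root := rfl
  depth_root := rfl
  depth_parent v hv := by
    rcases v with _ | ⟨b, h, j⟩
    · exact absurd rfl hv
    · by_cases hj : j.1 = 0
      · by_cases hh : 2 ≤ h.1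
        · have := Nat.log_two_half hh
          simp only [parent, hj, hh, depth, ne_eq, not_true, dite_false, dite_true, Fin.val_last]
          rw [← this]
          ring
        · have h1 := Finset.mem_Ico.1 h.2
          have h2 : h.1 = 1 := by omega
          simp [parent, hj, depth, h2]
      · simp only [parent, ne_eq, hj, not_false_iff, dite_true, depth]
        omega

theorem parent_eq_some {b b' : Fin m} {h h' : Finset.Ico 1 (2 ^ d)} {j j' : Fin (k + 1)} :
    parent (some (b', h', j')) = some (b, h, j) ↔ b' = b ∧
      ((h' = h ∧ j'.1 = j.1 + 1) ∨ (h'.1 / 2 = h.1 ∧ j'.1 = 0 ∧ j.1 = k)) := by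
  have hh := Finset.mem_Ico.1 h.2
  have hh' := Finset.mem_Ico.1 h'.2
  have hj := j.2
  by_cases hj' : j'.1 = 0
  · by_cases h2 : 2 ≤ h'.1
    · simp only [parent, hj', h2, ne_eq, not_true, dite_false, dite_true, Option.some.injEq,
        Prod.mk.injEq, Subtype.ext_iff, Fin.ext_iff, Fin.val_last, true_and]
      omega
    · simp only [parent, hj', h2, ne_eq, not_true, dite_false, reduceCtorEq, false_iff, true_and]
      rintro ⟨-, ⟨-, h1⟩ | ⟨h1, -⟩⟩ <;> omega
  · simp only [parent, hj', ne_eq, not_false_iff, dite_true, Option.some.injEq,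
        Prod.mk.injEq, Subtype.ext_iff, Fin.ext_iff, false_and, and_false, or_false]
    omega

open ParentTree

theorem card_below_eq (v : StretchedVertex m d k) :
    ((tree m d k).below v).card = 1 + ∑ c ∈ (tree m d k).children v,
      ((tree m d k).below c).card := by
  have := sum_below (T := tree m d k) v (fun _ => 1)
  simpa using this

theorem mem_children_iff {b : Fin m} {h : Finset.Ico 1 (2 ^ d)} {j : Fin (k + 1)}
    {c : StretchedVertex m d k} :
    c ∈ (tree m d k).children (some (b, h, j)) ↔ parent c = some (b, h, j) := by
  rw [mem_children]
  refine ⟨fun hc => hc.2, fun hc => ⟨?_, hc⟩⟩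
  rintro rfl
  exact absurd hc (by simp [tree, parent])

/-- The induction runs upwards from the deepest vertices, `N` bounding the distance to the bottom.
The subtree is a stretched binary tree with `d - Nat.log 2 h` levels minus the `j` vertices above on
the same path; the equation is arranged to avoid natural subtraction. -/
theorem card_below_some (N : ℕ) : ∀ (b : Fin m) (h : Finset.Ico 1 (2 ^ d)) (j : Fin (k + 1)),
    (k + 1) * d ≤ depth (some (b, h, j) : StretchedVertex m d k) + N →
    ((tree m d k).below (some (b, h, j))).card + j.1 + (k + 1) =
      (k + 1) * 2 ^ (d - Nat.log 2 h.1) := by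
  induction N with
  | zero =>
    intro b h j hN
    have hlog := log_lt h
    have hj := j.2
    simp only [depth, add_zero] at hN
    have h1 : d ≤ Nat.log 2 h.1 + 1 := by
      by_contra hlt
      have : (k + 1) * (Nat.log 2 h.1 + 2) ≤ (k + 1) * d := Nat.mul_le_mul_left _ (by omega)
      rw [Nat.mul_add] at this
      omega
    have h2 : d = Nat.log 2 h.1 + 1 := by omega
    have hjk : j.1 = k := by
      have h3 : (k + 1) * d = (k + 1) * Nat.log 2 h.1 + (k + 1) := by
        rw [← Nat.mul_succ, Nat.succ_eq_add_one, ← h2]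
      omega
    have hc : (tree m d k).children (some (b, h, j)) = ∅ := by
      rw [Finset.eq_empty_iff_forall_notMem]
      intro c hc
      have hd := depth_of_mem_children hc
      have h3 := depth_le c
      have h4 : depth c = (k + 1) * Nat.log 2 h.1 + j.1 + 1 + 1 := hd
      omega
    rw [card_below_eq, hc, Finset.sum_empty, hjk, show d - Nat.log 2 h.1 = 1 by omega]
    ring
  | succ N ih =>
    intro b h j hN
    have hlog := log_lt h
    have hj := j.2
    have hh := Finset.mem_Ico.1 h.2
    rw [card_below_eq]
    by_cases hjk : j.1 = k
    · by_cases hleaf : 2 * h.1 < 2 ^ d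
      · have hd0 : d ≠ 0 := by omega
        have heven : 2 ^ d = 2 * 2 ^ (d - 1) := by
          rw [← pow_succ']
          congr 1
          omega
        have e0 : 2 * h.1 ∈ Finset.Ico 1 (2 ^ d) := by rw [Finset.mem_Ico]; omega
        have e1 : 2 * h.1 + 1 ∈ Finset.Ico 1 (2 ^ d) := by rw [Finset.mem_Ico]; omega
        have hc : (tree m d k).children (some (b, h, j)) =
            {some (b, ⟨2 * h.1, e0⟩, 0), some (b, ⟨2 * h.1 + 1, e1⟩, 0)} := by
          ext c
          rw [mem_children_iff]
          rcases c with _ | ⟨b', h', j'⟩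
          · simp [parent]
          · rw [parent_eq_some]
            have := j'.2
            simp only [Finset.mem_insert, Finset.mem_singleton, Option.some.injEq,
              Prod.mk.injEq, Subtype.ext_iff, Fin.ext_iff, Fin.val_zero]
            omega
        have l0 : Nat.log 2 (2 * h.1) = Nat.log 2 h.1 + 1 := by
          rw [← Nat.log_two_half (by omega : 2 ≤ 2 * h.1)]
          congr 2
          omega
        have l1 : Nat.log 2 (2 * h.1 + 1) = Nat.log 2 h.1 + 1 := by
          rw [← Nat.log_two_half (by omega : 2 ≤ 2 * h.1 + 1)]
          congr 2
          omega
        have hl := log_lt ⟨_, e0⟩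
        simp only [l0] at hl
        rw [hc, Finset.sum_pair (by simp)]
        have i0 := ih b ⟨2 * h.1, e0⟩ 0 (by
          simp only [depth, l0, Nat.mul_add, Fin.val_zero] at hN ⊢
          omega)
        have i1 := ih b ⟨2 * h.1 + 1, e1⟩ 0 (by
          simp only [depth, l1, Nat.mul_add, Fin.val_zero] at hN ⊢
          omega)
        simp only [l0, l1, Fin.val_zero, add_zero] at i0 i1
        have hp : 2 ^ (d - Nat.log 2 h.1) = 2 * 2 ^ (d - (Nat.log 2 h.1 + 1)) := by
          rw [← pow_succ']
          congr 1
          omega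
        rw [hp, Nat.mul_left_comm]
        omega
      · have hc : (tree m d k).children (some (b, h, j)) = ∅ := by
          rw [Finset.eq_empty_iff_forall_notMem]
          intro c hc
          rw [mem_children_iff] at hc
          rcases c with _ | ⟨b', h', j'⟩
          · simp [parent] at hc
          · rw [parent_eq_some] at hc
            have := Finset.mem_Ico.1 h'.2
            omega
        have h2 : d - 1 ≤ Nat.log 2 h.1 := by
          refine Nat.le_log_of_pow_le (by norm_num) ?_
          have hd0 : d ≠ 0 := by omega
          have heven : 2 ^ d = 2 * 2 ^ (d - 1) := by
            rw [← pow_succ']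
            congr 1
            omega
          omega
        rw [hc, Finset.sum_empty, hjk, show d - Nat.log 2 h.1 = 1 by omega]
        ring
    · have hc : (tree m d k).children (some (b, h, j)) =
          {some (b, h, ⟨j.1 + 1, by omega⟩)} := by
        ext c
        rw [mem_children_iff]
        rcases c with _ | ⟨b', h', j'⟩
        · simp [parent]
        · rw [parent_eq_some]
          have := j'.2
          simp only [Finset.mem_singleton, Option.some.injEq,
            Prod.mk.injEq, Subtype.ext_iff, Fin.ext_iff]
          omega
      rw [hc, Finset.sum_singleton]
      have i0 := ih b h ⟨j.1 + 1, by omega⟩ (by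
        simp only [depth] at hN ⊢
        omega)
      simp only at i0
      omega

theorem card_below {v : StretchedVertex m d k} (hv : v ≠ (tree m d k).root) :
    ((tree m d k).below v).card + ((tree m d k).depth v - 1) % (k + 1) + (k + 1) =
      (k + 1) * 2 ^ (d - ((tree m d k).depth v - 1) / (k + 1)) := by
  rcases v with _ | ⟨b, h, j⟩
  · exact absurd rfl hv
  · have h1 : (tree m d k).depth (some (b, h, j)) - 1 = j.1 + (k + 1) * Nat.log 2 h.1 := by
      simp only [tree, depth]
      omega
    rw [h1, Nat.add_mul_mod_self_left, Nat.add_mul_div_left _ _ (Nat.succ_pos k),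
      Nat.mod_eq_of_lt j.2, Nat.div_eq_of_lt j.2, zero_add]
    exact card_below_some ((k + 1) * d) b h j (Nat.le_add_left _ _)

theorem card_eq : Fintype.card (StretchedVertex m d k) = m * ((k + 1) * (2 ^ d - 1)) + 1 := by
  simp [Nat.mul_comm (k + 1)]

/-- More than half of the binary nodes, those with `2 ^ (d - 1) ≤ h`, are on the last level; all
other depths are dropped. -/
theorem sum_depth_ge (hd : 1 ≤ d) :
    m * ((k + 1) * (2 ^ d - 1)) * ((k + 1) * (d - 1)) ≤
      2 * ∑ v : StretchedVertex m d k, (tree m d k).depth v := by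
  have h1 : ∀ (h : ℕ), (k + 1) * (if 2 ^ (d - 1) ≤ h then (k + 1) * (d - 1) else 0) ≤
      ∑ j : Fin (k + 1), ((k + 1) * Nat.log 2 h + j.1 + 1) := by
    intro h
    have : ∑ j : Fin (k + 1), (if 2 ^ (d - 1) ≤ h then (k + 1) * (d - 1) else 0) ≤
        ∑ j : Fin (k + 1), ((k + 1) * Nat.log 2 h + j.1 + 1) := by
      refine Finset.sum_le_sum fun j _ => ?_
      split_ifs with hh
      · have h2 : d - 1 ≤ Nat.log 2 h := Nat.le_log_of_pow_le (by norm_num) hh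
        have := Nat.mul_le_mul_left (k + 1) h2
        omega
      · exact Nat.zero_le _
    simpa using this
  have h2 : 2 ^ (d - 1) * ((k + 1) * (d - 1)) ≤
      ∑ h ∈ Finset.Ico 1 (2 ^ d), (if 2 ^ (d - 1) ≤ h then (k + 1) * (d - 1) else 0) := by
    have hsub : Finset.Ico (2 ^ (d - 1)) (2 ^ d) ⊆ Finset.Ico 1 (2 ^ d) :=
      Finset.Ico_subset_Ico_left Nat.one_le_two_pow
    refine le_trans ?_ (Finset.sum_le_sum_of_subset hsub)
    have h3 : ∀ h ∈ Finset.Ico (2 ^ (d - 1)) (2 ^ d),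
        (if 2 ^ (d - 1) ≤ h then (k + 1) * (d - 1) else 0) = (k + 1) * (d - 1) := by
      intro h hh
      rw [if_pos (Finset.mem_Ico.1 hh).1]
    rw [Finset.sum_congr rfl h3, Finset.sum_const, Nat.card_Ico, smul_eq_mul]
    have heven : 2 ^ d = 2 * 2 ^ (d - 1) := by
      rw [← pow_succ']
      congr 1
      omega
    refine Nat.mul_le_mul_right _ ?_
    omega
  have h4 : ∑ v : StretchedVertex m d k, (tree m d k).depth v =
      m * ∑ h ∈ Finset.Ico 1 (2 ^ d), ∑ j : Fin (k + 1), ((k + 1) * Nat.log 2 h + j.1 + 1) := by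
    rw [Fintype.sum_option, Fintype.sum_prod_type]
    simp only [Fintype.sum_prod_type, tree, depth]
    rw [Finset.sum_const, Finset.card_univ, Fintype.card_fin, smul_eq_mul, zero_add]
    congr 1
    exact Finset.sum_coe_sort (Finset.Ico 1 (2 ^ d))
      (fun h => ∑ j : Fin (k + 1), ((k + 1) * Nat.log 2 h + j.1 + 1))
  rw [h4]
  have h5 := Finset.sum_le_sum (s := Finset.Ico 1 (2 ^ d)) fun h _ => h1 h
  rw [← Finset.mul_sum] at h5
  have h6 : 2 ^ d - 1 ≤ 2 * 2 ^ (d - 1) := by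
    rw [← pow_succ']
    have : d - 1 + 1 = d := by omega
    rw [this]
    exact Nat.sub_le _ _
  calc m * ((k + 1) * (2 ^ d - 1)) * ((k + 1) * (d - 1))
      ≤ m * ((k + 1) * (2 * 2 ^ (d - 1))) * ((k + 1) * (d - 1)) := by gcongr
    _ = 2 * (m * ((k + 1) * (2 ^ (d - 1) * ((k + 1) * (d - 1))))) := by ring
    _ ≤ 2 * (m * _) := by
      refine Nat.mul_le_mul_left _ (Nat.mul_le_mul_left _ (le_trans ?_ h5))
      exact Nat.mul_le_mul_left _ h2

end StretchedVertex

/-- Stretched binary trees with vertices `Fin n`. -/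
theorem exists_stretched_tree {m d k n : ℕ} (hd : 1 ≤ d)
    (hn : n = m * ((k + 1) * (2 ^ d - 1)) + 1) :
    ∃ T : ParentTree (Fin n), (∀ x, T.depth x ≤ (k + 1) * d) ∧
      (∀ z, z ≠ T.root → (T.below z).card + (T.depth z - 1) % (k + 1) + (k + 1) =
        (k + 1) * 2 ^ (d - (T.depth z - 1) / (k + 1))) ∧
      m * ((k + 1) * (2 ^ d - 1)) * ((k + 1) * (d - 1)) ≤ 2 * ∑ x, T.depth x := by
  have hcard : Fintype.card (StretchedVertex m d k) = n := by
    rw [hn, StretchedVertex.card_eq]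
  let e := Fintype.equivFinOfCardEq hcard
  refine ⟨(StretchedVertex.tree m d k).map e, fun x => StretchedVertex.depth_le _, ?_, ?_⟩
  · intro z hz
    rw [ParentTree.card_below_map]
    exact StretchedVertex.card_below fun h => hz (e.symm_apply_eq.1 h)
  · refine (StretchedVertex.sum_depth_ge hd).trans (le_of_eq ?_)
    congr 1
    exact (Equiv.sum_comp e.symm (StretchedVertex.tree m d k).depth).symm

namespace ParentTree

/-! ### Stretched trees satisfy the swap condition -/

variable {V : Type*} [Fintype V] {T : ParentTree V} {d k : ℕ}

theorem sum_swap_of_stretched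
    (hD : ∀ x, T.depth x ≤ (k + 1) * d)
    (hsize : ∀ z, z ≠ T.root → (T.below z).card + (T.depth z - 1) % (k + 1) + (k + 1) =
      (k + 1) * 2 ^ (d - (T.depth z - 1) / (k + 1))) {c v : V} (hc : c ≠ T.root)
    (hv : T.Desc c v) :
    ∑ x ∈ T.below c, ((T.graph.dist (T.parent c) x : ℝ) - 1 - T.graph.dist v x) ≤ 0 ∨
      T.depth v ≤ T.depth c + 4 * k := by
  have hpos : ∀ z, z ≠ T.root → 1 ≤ T.depth z := fun z hz =>
    Nat.one_le_iff_ne_zero.2 fun h => hz (T.depth_eq_zero.1 h)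
  have hdivmod := fun z => Nat.div_add_mod (T.depth z - 1) (k + 1)
  have hmod := fun z => Nat.mod_lt (T.depth z - 1) (Nat.succ_pos k)
  have hlev : ∀ z, z ≠ T.root → (T.depth z - 1) / (k + 1) < d := by
    intro z hz
    have := hD z
    have := hpos z hz
    refine (Nat.div_lt_iff_lt_mul (Nat.succ_pos k)).2 ?_
    rw [Nat.mul_comm, Nat.succ_eq_add_one]
    omega
  -- Descending `i` levels divides the subtree size by at least `2 ^ i`; for `1 ≤ i` the correction
  -- terms in `hsize` help.
  have key : ∀ (i : ℕ) (z : V), z ≠ T.root → 1 ≤ i →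
      (T.depth c - 1) / (k + 1) + i ≤ (T.depth z - 1) / (k + 1) →
      2 ^ i * (T.below z).card ≤ (T.below c).card := by
    intro i z hz hi hle
    have hz1 := hsize z hz
    have hc1 := hsize c hc
    have hl := hlev z hz
    have hmc := hmod c
    set lz := (T.depth z - 1) / (k + 1)
    set lc := (T.depth c - 1) / (k + 1)
    have e1 : (T.below z).card + (k + 1) ≤ (k + 1) * 2 ^ (d - lz) := by omega
    have e2 : 2 ^ i * 2 ^ (d - lz) ≤ 2 ^ (d - lc) := by
      rw [← pow_add]
      exact Nat.pow_le_pow_right (by norm_num) (by omega)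
    have e3 : 2 ^ i * ((T.below z).card + (k + 1)) ≤ (k + 1) * 2 ^ (d - lc) :=
      calc 2 ^ i * ((T.below z).card + (k + 1)) ≤ 2 ^ i * ((k + 1) * 2 ^ (d - lz)) := by gcongr
        _ = (k + 1) * (2 ^ i * 2 ^ (d - lz)) := by ring
        _ ≤ _ := by gcongr
    have e4 : 2 * (k + 1) ≤ 2 ^ i * (k + 1) := by
      have : 2 ^ 1 ≤ 2 ^ i := Nat.pow_le_pow_right (by norm_num) hi
      exact Nat.mul_le_mul_right _ (by simpa using this)
    rw [Nat.mul_add] at e3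
    simp only [Nat.succ_eq_add_one] at hmc
    omega
  have hstep : ∀ (i : ℕ) (z : V),
      T.depth c + (k - (T.depth c - 1) % (k + 1)) + (k + 1) * i < T.depth z →
      (T.depth c - 1) / (k + 1) + (i + 1) ≤ (T.depth z - 1) / (k + 1) := by
    intro i z h
    rw [Nat.le_div_iff_mul_le (Nat.succ_pos k)]
    have h1 := hdivmod c
    have h2 := hmod c
    have h3 := hpos c hc
    have h4 : ((T.depth c - 1) / (k + 1) + (i + 1)) * (k + 1) =
        (k + 1) * ((T.depth c - 1) / (k + 1)) + (k + 1) * i + (k + 1) := by ring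
    rw [h4]
    simp only [Nat.succ_eq_add_one] at h2
    omega
  -- `q` is the number of steps from `c` to the end of its own path; another `k + 1` steps complete
  -- the next level.
  have hq : k - (T.depth c - 1) % (k + 1) + 1 ≤ k + 1 := by omega
  have := sum_swap_nonpos_or hq hc
    (fun z hz h => by
      simpa using key 1 z (hz.ne_root hc) le_rfl (hstep 0 z (by simpa using h)))
    (fun z hz h => by
      simpa using key 2 z (hz.ne_root hc) (by norm_num) (hstep 1 z (by simpa using h))) hv
  simpa using this

theorem card_below_of_stretched
    (hsize : ∀ z, z ≠ T.root → (T.below z).card + (T.depth z - 1) % (k + 1) + (k + 1) =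
      (k + 1) * 2 ^ (d - (T.depth z - 1) / (k + 1))) {b : V} (hb : T.depth b = 1) :
    (T.below b).card ≤ (k + 1) * (2 ^ d - 1) := by
  have h := hsize b fun h => by rw [h, T.depth_root] at hb; omega
  rw [hb] at h
  simp only [Nat.sub_self, Nat.zero_mod, Nat.zero_div, Nat.sub_zero, add_zero] at h
  rw [Nat.mul_sub, mul_one]
  omega

end ParentTree

/-! ### Social cost of the tree and of the optimum -/

namespace ParentTree

variable {V : Type*} [Fintype V]

theorem socialCost_graph_ge (T : ParentTree V) {t : ℕ} {α : ℝ} (hα : 0 ≤ α) (M : ℕ)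
    (ht : ∀ b, T.depth b = 1 → (T.below b).card ≤ t) :
    2 * ((Fintype.card V : ℝ) - t) * ∑ x, (T.depth x : ℝ) ≤ socialCost α M T.graph := by
  classical
  -- Pairs in the same branch are estimated by distance 0. Each vertex has at most `t` such
  -- partners, which turns the factor `card V` into `card V - t`.
  let P : V → V → Prop := fun u v => u ≠ T.root ∧ v ≠ T.root ∧ T.branch u = T.branch v
  have hPs : ∀ u v, P u v ↔ P v u := fun u v =>
    ⟨fun h => ⟨h.2.1, h.1, h.2.2.symm⟩, fun h => ⟨h.2.1, h.1, h.2.2.symm⟩⟩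
  have hbr : ∀ x, x ≠ T.root → T.branch x ≠ T.branch T.root := by
    intro x hx h
    have h1 := T.depth_branch hx
    have h2 := (T.desc_branch T.root).depth_le
    rw [h] at h1
    rw [T.depth_root] at h2
    omega
  have hdist : ∀ u v, ((T.depth u : ℝ) + T.depth v) -
      (if P u v then (T.depth u : ℝ) else 0) - (if P v u then (T.depth v : ℝ) else 0) ≤
      T.graph.dist u v := by
    intro u v
    rw [if_congr (hPs v u) rfl rfl]
    by_cases hP : P u v
    · have : (0 : ℝ) ≤ T.graph.dist u v := Nat.cast_nonneg _
      rw [if_pos hP, if_pos hP]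
      linarith
    · have : T.graph.dist u v = T.depth u + T.depth v := by
        by_cases hu : u = T.root
        · by_cases hv : v = T.root
          · rw [hu, hv, SimpleGraph.dist_self, T.depth_root]
          · rw [SimpleGraph.dist_comm, T.dist_eq_depth_add hv (hu ▸ hbr v hv), add_comm]
        · refine T.dist_eq_depth_add hu fun hb => ?_
          by_cases hv : v = T.root
          · exact hbr u hu (hv ▸ hb)
          · exact hP ⟨hu, hv, hb⟩
      rw [if_neg hP, if_neg hP, this]
      push_cast
      linarith
  set Δ : ℝ := ∑ x, (T.depth x : ℝ) with hΔ
  have hPsum : ∑ u, ∑ v, (if P u v then (T.depth u : ℝ) else 0) ≤ t * Δ := by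
    rw [hΔ, Finset.mul_sum]
    refine Finset.sum_le_sum fun u _ => ?_
    rw [← Finset.sum_filter, Finset.sum_const, nsmul_eq_mul]
    by_cases hu : u = T.root
    · simp [hu, T.depth_root]
    · gcongr
      refine le_trans (Finset.card_le_card fun v hv => ?_) (ht _ (T.depth_branch hu))
      rw [mem_below, (Finset.mem_filter.1 hv).2.2.2]
      exact T.desc_branch v
  have hPsum' : ∑ u, ∑ v, (if P v u then (T.depth v : ℝ) else 0) ≤ t * Δ := by
    rw [Finset.sum_comm]
    exact hPsum
  have htot : ∑ u : V, ∑ v : V, ((T.depth u : ℝ) + T.depth v) = 2 * (Fintype.card V : ℝ) * Δ := by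
    simp only [Finset.sum_add_distrib, Finset.sum_const, Finset.card_univ, nsmul_eq_mul,
      ← Finset.mul_sum, ← hΔ]
    ring
  have hle : ∑ u, ∑ v, (T.graph.dist u v : ℝ) ≤ socialCost α M T.graph := by
    rw [socialCost]
    refine Finset.sum_le_sum fun u _ => ?_
    rw [agentCost_of_connected T.connected]
    have : 0 ≤ α * ((T.graph.neighborSet u).ncard : ℝ) := by positivity
    linarith
  have h1 := Finset.sum_le_sum (s := Finset.univ) fun u (_ : u ∈ Finset.univ) =>
    Finset.sum_le_sum (s := Finset.univ) fun v (_ : v ∈ Finset.univ) => hdist u v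
  simp only [Finset.sum_sub_distrib] at h1
  rw [htot] at h1
  linarith

end ParentTree

open scoped Classical in
/-- The star with center `r`. -/
noncomputable def starTree {V : Type*} (r : V) : ParentTree V where
  root := r
  parent _ := r
  depth x := if x = r then 0 else 1
  parent_root := rfl
  depth_root := if_pos rfl
  depth_parent v hv := by simp [hv]

theorem optCost_le {V : Type*} [Fintype V] [Nonempty V] {α : ℝ} (hα : 0 ≤ α) (M : ℕ) :
    optCost V α M ≤ 2 * α * Fintype.card V + 2 * (Fintype.card V : ℝ) ^ 2 := by
  classical
  obtain ⟨r⟩ := ‹Nonempty V›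
  refine (ciInf_le (Set.finite_range _).bddBelow (starTree r).graph).trans ?_
  have hdeg : ∀ u, (((starTree r).graph.neighborSet u).ncard : ℝ) ≤
      1 + if u = r then (Fintype.card V : ℝ) - 1 else 0 := by
    intro u
    split_ifs with hu
    · have h := Set.ncard_le_card ((starTree r).graph.neighborSet u)
      rw [Nat.card_eq_fintype_card] at h
      have : (((starTree r).graph.neighborSet u).ncard : ℝ) ≤ Fintype.card V := by exact_mod_cast h
      linarith
    · have h : (starTree r).graph.neighborSet u ⊆ {r} := by
        intro x hx
        rcases (starTree r).adj_iff.1 hx with ⟨-, h⟩ | ⟨-, h⟩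
        · exact h.symm
        · exact absurd h.symm hu
      have h1 := Set.ncard_le_ncard h
      rw [Set.ncard_singleton] at h1
      rw [add_zero]
      exact_mod_cast h1
  have hdist : ∀ u v, ((starTree r).graph.dist u v : ℝ) ≤ 2 := by
    intro u v
    have := ParentTree.dist_le_two_mul (T := starTree r) (D := 1)
      (fun x => by simp only [starTree]; split_ifs <;> omega) u v
    simpa using this
  have hcost : ∀ u, agentCost α M (starTree r).graph u ≤
      α * (1 + if u = r then (Fintype.card V : ℝ) - 1 else 0) + 2 * Fintype.card V := by
    intro u
    rw [agentCost_of_connected (starTree r).connected]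
    refine add_le_add (mul_le_mul_of_nonneg_left (hdeg u) hα) ?_
    refine (Finset.sum_le_sum fun v _ => hdist u v).trans (le_of_eq ?_)
    simp [mul_comm]
  refine (Finset.sum_le_sum fun u _ => hcost u).trans ?_
  rw [Finset.sum_add_distrib, ← Finset.mul_sum, Finset.sum_add_distrib]
  simp only [Finset.sum_const, Finset.card_univ, nsmul_eq_mul, mul_one, Finset.sum_ite_eq',
    Finset.mem_univ, if_true]
  nlinarith

theorem optCost_pos {V : Type*} [Fintype V] [Nontrivial V] {α : ℝ} (hα : 0 ≤ α) {M : ℕ}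
    (hM : 0 < M) : 0 < optCost V α M := by
  obtain ⟨H, hH, -⟩ := exists_socialCost_eq_optCost V α M
  rw [← hH]
  obtain ⟨u, v, huv⟩ := exists_pair_ne V
  have h0 : ∀ u, 0 ≤ ∑ v, agentDist M H u v := fun u =>
    Finset.sum_nonneg fun v _ => agentDist_nonneg M H u v
  have h1 : 0 < agentDist M H u v := by
    rw [agentDist]
    split_ifs with h
    · exact_mod_cast h.pos_dist_of_ne huv
    · exact_mod_cast hM
  have h2 : ∀ u, ∑ v, agentDist M H u v ≤ agentCost α M H u := by
    intro u
    rw [agentCost]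
    have : 0 ≤ α * ((H.neighborSet u).ncard : ℝ) := by positivity
    linarith
  calc 0 < agentDist M H u v := h1
    _ ≤ ∑ v, agentDist M H u v :=
      Finset.single_le_sum (fun w _ => agentDist_nonneg M H u w) (Finset.mem_univ v)
    _ ≤ agentCost α M H u := h2 u
    _ ≤ socialCost α M H :=
      Finset.single_le_sum (f := fun u => agentCost α M H u) (fun w _ => (h0 w).trans (h2 w))
        (Finset.mem_univ u)

/-- Stretched binary trees attached to a common root are in equilibrium and expensive. -/
theorem exists_isBNE_tree {η d k : ℕ} {α : ℝ} (hα : 1 ≤ α) (hd : 1 ≤ d)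
    (ht : 4 * ((k + 1) * (2 ^ d - 1)) ≤ η)
    (hlt : 12 * k * (η : ℝ) + (2 + 3 * ((k + 1) * d) * η / α) *
      (2 * ((k + 1) * (2 ^ d - 1) : ℕ) * ((k + 1) * d)) < α) :
    ∃ n : ℕ, (η : ℝ) ≤ (n : ℝ) ∧ (n : ℝ) ≤ 3 / 2 * (η : ℝ) ∧
      ∃ G : SimpleGraph (Fin n), G.IsTree ∧ ∀ M : ℕ, α * (n : ℝ) ^ 3 < (M : ℝ) →
        IsBNE α M G ∧
        3 / 8 * (η / (α + η + 1)) * ((k + 1) * (d - 1)) ≤ socialCostRatio α M G := by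
  have h2d : 2 ≤ 2 ^ d := by
    calc 2 = 2 ^ 1 := rfl
      _ ≤ 2 ^ d := Nat.pow_le_pow_right (by norm_num) hd
  set t : ℕ := (k + 1) * (2 ^ d - 1) with htdef
  have ht1 : 1 ≤ t := Nat.mul_pos (Nat.succ_pos k) (by omega)
  -- The least number of copies with more than `η` non-root vertices; the overshoot is at most `t ≤
  -- η / 4`, so `n ≤ 3 / 2 * η`.
  set m : ℕ := η / t + 1 with hm
  set n : ℕ := m * t + 1 with hn
  have hm1 : η < m * t := by
    rw [mul_comm]
    exact Nat.lt_mul_div_succ η ht1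
  have hm2 : m * t ≤ η + t := by
    rw [hm, Nat.add_mul, one_mul]
    exact Nat.add_le_add_right (Nat.div_mul_le_self η t) t
  have hηn : η + 1 ≤ n := by omega
  have hn2 : 2 * n ≤ 3 * η := by omega
  have htn : 4 * t ≤ n := by omega
  have hηnR : (η : ℝ) + 1 ≤ n := by exact_mod_cast hηn
  have hn2R : 2 * (n : ℝ) ≤ 3 * η := by exact_mod_cast hn2
  have htnR : 4 * (t : ℝ) ≤ n := by exact_mod_cast htn
  have hα0 : 0 < α := by linarith
  obtain ⟨T, hD, hsize, hsum⟩ := exists_stretched_tree (m := m) (d := d) (k := k) (n := n) hd rfl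
  have hbelow : ∀ b, T.depth b = 1 → (T.below b).card ≤ t := fun b hb =>
    ParentTree.card_below_of_stretched hsize hb
  refine ⟨n, by linarith, by linarith, T.graph, T.isTree, fun M hM => ⟨?_, ?_⟩⟩
  · have h2n : 2 ≤ Fintype.card (Fin n) := by
      rw [Fintype.card_fin]
      omega
    refine T.isBNE hα h2n (by simpa using hM) hD hbelow
      (fun c v hc hv => ParentTree.sum_swap_of_stretched hD hsize hc hv) (lt_of_le_of_lt ?_ hlt)
    rw [Fintype.card_fin]
    push_cast
    have h1 : 2 * (4 * (k : ℝ)) * n ≤ 12 * k * η := by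
      have := mul_le_mul_of_nonneg_left hn2R (Nat.cast_nonneg (α := ℝ) k)
      linarith
    have h2 : 2 * (((k : ℝ) + 1) * d) * n ≤ 3 * (((k : ℝ) + 1) * d) * η := by
      have := mul_le_mul_of_nonneg_left hn2R (by positivity : (0 : ℝ) ≤ ((k : ℝ) + 1) * d)
      linarith
    gcongr
  · have hMpos : 0 < M := by
      have : (0 : ℝ) < M := lt_of_le_of_lt (by positivity) hM
      exact_mod_cast this
    have : Nontrivial (Fin n) := Fin.nontrivial_iff_two_le.2 (by omega)
    rw [socialCostRatio, le_div_iff₀ (optCost_pos hα0.le hMpos)]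
    have hopt := optCost_le (V := Fin n) hα0.le M
    have hsoc := T.socialCost_graph_ge hα0.le M hbelow
    rw [Fintype.card_fin] at hopt hsoc
    set Q : ℝ := ((k : ℝ) + 1) * (d - 1) with hQ
    have hQ0 : 0 ≤ Q := by
      have : (1 : ℝ) ≤ d := by exact_mod_cast hd
      exact mul_nonneg (by positivity) (by linarith)
    have hsumR : ((n : ℝ) - 1) * Q ≤ 2 * ∑ x, (T.depth x : ℝ) := by
      have h1 : ((m * t * ((k + 1) * (d - 1)) : ℕ) : ℝ) ≤ ((2 * ∑ x, T.depth x : ℕ) : ℝ) :=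
        Nat.cast_le.2 hsum
      have h2 : ((m * t * ((k + 1) * (d - 1)) : ℕ) : ℝ) = ((n : ℝ) - 1) * Q := by
        rw [hn, hQ]
        push_cast [Nat.cast_sub hd]
        ring
      rw [← h2]
      simpa using h1
    have hn0 : (0 : ℝ) ≤ n := Nat.cast_nonneg _
    have hη0 : (0 : ℝ) ≤ η := Nat.cast_nonneg _
    calc 3 / 8 * (η / (α + η + 1)) * Q * optCost (Fin n) α M
        ≤ 3 / 8 * (η / (α + η + 1)) * Q * (2 * α * n + 2 * (n : ℝ) ^ 2) := by gcongr
      -- Here `n - t ≥ 3 / 4 * n`, and `(n - 1) / (α + n)` increases with `n`, so it is bounded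
      -- below by its value at `η + 1`.
      _ = (η / (α + η + 1) * (α + n)) * (3 / 4 * n) * Q := by ring
      _ ≤ ((n : ℝ) - 1) * (n - t) * Q := by
        gcongr ?_ * ?_ * Q
        · linarith
        · rw [div_mul_eq_mul_div, div_le_iff₀ (by linarith)]
          nlinarith [mul_nonneg (by linarith : 0 ≤ (n : ℝ) - 1 - η) (by linarith : 0 ≤ α + 1)]
        · linarith
      _ = ((n : ℝ) - t) * (((n : ℝ) - 1) * Q) := by ring
      _ ≤ ((n : ℝ) - t) * (2 * ∑ x, (T.depth x : ℝ)) := by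
        refine mul_le_mul_of_nonneg_left hsumR ?_
        linarith [Nat.cast_nonneg (α := ℝ) t]
      _ = 2 * ((n : ℝ) - t) * ∑ x, (T.depth x : ℝ) := by ring
      _ ≤ _ := hsoc

/-! ### Choice of the parameters -/

open Filter in
-- The 50 absorbs the factors `d ^ 2` in the equilibrium condition; the 4 makes the power at least
-- 4, which gives `4 * t ≤ η`.
theorem eventually_sq_logb_le_rpow {e : ℝ} (he : 0 < e) :
    ∀ᶠ x : ℝ in atTop, 50 * Real.logb 2 x ^ 2 + 4 ≤ x ^ (e / 4) := by
  have h1 : (fun x : ℝ => Real.log x ^ (2 : ℝ)) =o[atTop] fun x => x ^ (e / 4) :=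
    isLittleO_log_rpow_rpow_atTop 2 (by positivity)
  have hc : 0 < Real.log 2 ^ 2 / 100 := by
    have := Real.log_pos (by norm_num : (1 : ℝ) < 2)
    positivity
  have h2 := h1.bound hc
  have h3 : ∀ᶠ x : ℝ in atTop, 8 ≤ x ^ (e / 4) :=
    (tendsto_rpow_atTop (by positivity : 0 < e / 4)).eventually_ge_atTop 8
  filter_upwards [h2, h3, eventually_gt_atTop 0] with x hx hx' hx0
  have hl := Real.log_pos (by norm_num : (1 : ℝ) < 2)
  rw [Real.rpow_two, Real.norm_of_nonneg (sq_nonneg _),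
    Real.norm_of_nonneg (Real.rpow_nonneg hx0.le _)] at hx
  have h4 : Real.logb 2 x ^ 2 ≤ x ^ (e / 4) / 100 := by
    rw [Real.logb, div_pow, div_le_iff₀ (by positivity)]
    linarith
  linarith

/-- A height `d` of about `3 / 4 * e * log η` together with `P = η ^ (e / 4)`. -/
theorem exists_height {e : ℝ} (he : 0 < e) (he1 : e ≤ 1) : ∃ N : ℕ, ∀ η : ℕ, N ≤ η →
    ∃ d : ℕ, 100 ≤ η ∧ 1 ≤ d ∧ 3 / 4 * e * Real.logb 2 η - 1 ≤ d ∧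
      (2 : ℝ) ^ d ≤ ((η : ℝ) ^ (e / 4)) ^ 3 ∧ 50 * (d : ℝ) ^ 2 + 4 ≤ (η : ℝ) ^ (e / 4) := by
  have h1 := (tendsto_natCast_atTop_atTop (R := ℝ)).eventually (eventually_sq_logb_le_rpow he)
  have h2 : ∀ᶠ η : ℕ in Filter.atTop, 4 / (3 * e) ≤ Real.logb 2 (η : ℝ) :=
    ((Real.tendsto_logb_atTop (by norm_num)).comp
      (tendsto_natCast_atTop_atTop (R := ℝ))).eventually_ge_atTop _
  obtain ⟨N, hN⟩ := Filter.eventually_atTop.1 ((h1.and h2).and (Filter.eventually_ge_atTop 100))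
  refine ⟨N, fun η hη => ?_⟩
  obtain ⟨⟨h3, h4⟩, h5⟩ := hN η hη
  have hη0 : (0 : ℝ) < η := by
    have : 0 < η := by omega
    exact_mod_cast this
  set x := Real.logb 2 (η : ℝ) with hx
  have hx0 : 0 < x := lt_of_lt_of_le (by positivity) h4
  have h6 : 1 ≤ 3 / 4 * e * x := by
    rw [div_le_iff₀ (by positivity)] at h4
    linarith
  have hfl := Nat.floor_le (by positivity : 0 ≤ 3 / 4 * e * x)
  refine ⟨⌊3 / 4 * e * x⌋₊, h5, Nat.le_floor (by simpa using h6), ?_, ?_, ?_⟩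
  · have := Nat.lt_floor_add_one (3 / 4 * e * x)
    linarith
  · rw [← Real.rpow_natCast, ← Real.rpow_natCast, ← Real.rpow_mul hη0.le]
    have : (η : ℝ) = (2 : ℝ) ^ x := (Real.rpow_logb (by norm_num) (by norm_num) hη0).symm
    rw [this, ← Real.rpow_mul (by norm_num)]
    refine Real.rpow_le_rpow_of_exponent_le (by norm_num) (hfl.trans (le_of_eq ?_))
    push_cast
    ring
  · refine le_trans ?_ h3
    have h7 : (⌊3 / 4 * e * x⌋₊ : ℝ) ≤ x := hfl.trans (by nlinarith)
    gcongr

theorem mainTheorem4 :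
    (∀ ε : ℝ, 0 < ε → ε ≤ 1 → ∃ N : ℕ, ∀ η : ℕ, N ≤ η → ∀ α : ℝ,
      9 * (η : ℝ) ≤ α → α ≤ (η : ℝ) ^ (2 - ε) →
        ∃ n : ℕ, (η : ℝ) ≤ (n : ℝ) ∧ (n : ℝ) ≤ 3 / 2 * (η : ℝ) ∧
          ∃ G : SimpleGraph (Fin n), G.IsTree ∧
            ∀ M : ℕ, α * (n : ℝ) ^ 3 < (M : ℝ) →
              IsBNE α M G ∧
              ε / 168 * Real.logb 2 α - 3 / 28 ≤ socialCostRatio α M G) ∧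
    (∀ ε : ℝ, 0 < ε → ε ≤ 1 / 2 → ∃ N : ℕ, ∀ η : ℕ, N ≤ η → ∀ α : ℝ,
      (η : ℝ) ^ (1 / 2 + ε) ≤ α → α ≤ (η : ℝ) →
        ∃ n : ℕ, (η : ℝ) ≤ (n : ℝ) ∧ (n : ℝ) ≤ 3 / 2 * (η : ℝ) ∧
          ∃ G : SimpleGraph (Fin n), G.IsTree ∧
            ∀ M : ℕ, α * (n : ℝ) ^ 3 < (M : ℝ) →
              IsBNE α M G ∧
              1 / 4 * ε * Real.logb 2 α - 9 / 8 ≤ socialCostRatio α M G) := by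
  constructor
  · intro ε hε hε1
    obtain ⟨N, hN⟩ := exists_height hε hε1
    refine ⟨N, fun η hη α hα1 hα2 => ?_⟩
    obtain ⟨d, hη100, hd, hdlog, hS, hP⟩ := hN η hη
    have hηR : (100 : ℝ) ≤ η := by exact_mod_cast hη100
    have hη0 : (0 : ℝ) < η := by linarith
    have hα0 : 0 < α := by linarith
    have hdR : (1 : ℝ) ≤ d := by exact_mod_cast hd
    have hPα : α * ((η : ℝ) ^ (ε / 4)) ^ 4 ≤ (η : ℝ) ^ 2 := by
      have h1 : ((η : ℝ) ^ (ε / 4)) ^ 4 = (η : ℝ) ^ ε := by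
        rw [← Real.rpow_natCast, ← Real.rpow_mul hη0.le]
        congr 1
        push_cast
        ring
      have h2 : (η : ℝ) ^ 2 = (η : ℝ) ^ (2 - ε) * (η : ℝ) ^ ε := by
        rw [← Real.rpow_add hη0, sub_add_cancel, Real.rpow_two]
      rw [h1, h2]
      gcongr
    have hlog : Real.logb 2 α ≤ 2 * Real.logb 2 η := by
      calc Real.logb 2 α ≤ Real.logb 2 ((η : ℝ) ^ (2 - ε)) :=
            Real.logb_le_logb_of_le (by norm_num) hα0 hα2
        _ = (2 - ε) * Real.logb 2 η := Real.logb_rpow_eq_mul_logb_of_pos hη0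
        _ ≤ 2 * Real.logb 2 η := by
          have : 0 ≤ Real.logb 2 (η : ℝ) := Real.logb_nonneg (by norm_num) (by linarith)
          gcongr
          linarith
    generalize (η : ℝ) ^ (ε / 4) = P at *
    have hP0 : 0 < P := by nlinarith
    -- With this path length `k + 1`, the term `12 * k * η` stays below `4 / 5 * α`. The remaining
    -- fifth covers the other term, as `50 * d ^ 2 ≤ P` and `K ^ 2 * P ^ 4 ≤ α`.
    have hceil : 0 < ⌈α / (15 * η)⌉₊ := Nat.ceil_pos.2 (by positivity)
    obtain ⟨k, hk⟩ : ∃ k, ⌈α / (15 * η)⌉₊ = k + 1 := ⟨_, (Nat.succ_pred_eq_of_pos hceil).symm⟩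
    have hk1 : α ≤ 15 * ((k + 1) * η) := by
      have := Nat.le_ceil (α / (15 * (η : ℝ)))
      rw [hk, div_le_iff₀ (by positivity)] at this
      push_cast at this
      linarith
    have hk2 : 15 * (k * (η : ℝ)) < α := by
      have := Nat.ceil_lt_add_one (by positivity : 0 ≤ α / (15 * (η : ℝ)))
      rw [hk] at this
      push_cast at this
      have h : (k : ℝ) < α / (15 * η) := by linarith
      rw [lt_div_iff₀ (by positivity)] at h
      linarith
    set K : ℝ := (k : ℝ) + 1 with hK
    have hK1 : 1 ≤ K := by rw [hK]; linarith [Nat.cast_nonneg (α := ℝ) k]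
    have hKη : K * η ≤ α := by
      rw [hK]
      linarith
    set t : ℕ := (k + 1) * (2 ^ d - 1) with ht
    have htR : (t : ℝ) ≤ K * P ^ 3 := by
      have h1 : t ≤ (k + 1) * 2 ^ d := Nat.mul_le_mul_left _ (Nat.sub_le _ _)
      have h2 : (t : ℝ) ≤ K * 2 ^ d := by
        rw [hK]
        exact_mod_cast h1
      exact h2.trans (by gcongr)
    have ht4 : 4 * t ≤ η := by
      have h1 : 4 * (K * P ^ 3) * η ≤ η * η := by
        have e1 : (K * η) * (4 * P ^ 3) ≤ α * (P * P ^ 3) := by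
          gcongr
          nlinarith
        nlinarith
      have h2 : 4 * (K * P ^ 3) ≤ η := le_of_mul_le_mul_right h1 hη0
      have : 4 * (t : ℝ) ≤ η := by linarith
      exact_mod_cast this
    obtain ⟨n, hn1, hn2, G, hG, hGM⟩ := exists_isBNE_tree (η := η) (d := d) (k := k) (α := α)
      (by linarith) hd ht4 (by
        have e1 : 2 + 3 * (K * d) * η / α ≤ 5 * d := by
          have : 3 * (K * d) * η / α ≤ 3 * d := by
            rw [div_le_iff₀ hα0]
            calc 3 * (K * d) * η = 3 * d * (K * η) := by ring
              _ ≤ 3 * d * α := by gcongr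
          linarith
        have e2 : 2 * (t : ℝ) * (K * d) ≤ 2 * (K * P ^ 3) * (K * d) := by gcongr
        have e3 : (2 + 3 * (K * d) * η / α) * (2 * t * (K * d)) ≤
            (5 * d) * (2 * (K * P ^ 3) * (K * d)) := by gcongr
        have e4 : K ^ 2 * P ^ 4 ≤ α := by
          have : (K ^ 2 * P ^ 4) * η ^ 2 ≤ α * η ^ 2 := by
            calc (K ^ 2 * P ^ 4) * (η : ℝ) ^ 2 = (K * η) * (K * η) * P ^ 4 := by ring
              _ ≤ α * α * P ^ 4 := by gcongr
              _ = α * (α * P ^ 4) := by ring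
              _ ≤ α * (η : ℝ) ^ 2 := by gcongr
          exact le_of_mul_le_mul_right this (by positivity)
        have e5 : 5 * ((5 * d) * (2 * (K * P ^ 3) * (K * d))) ≤ K ^ 2 * P ^ 4 := by
          calc 5 * ((5 * d) * (2 * (K * P ^ 3) * (K * d))) = (K ^ 2 * P ^ 3) * (50 * d ^ 2) := by
                ring
            _ ≤ (K ^ 2 * P ^ 3) * P := by
              gcongr
              linarith
            _ = K ^ 2 * P ^ 4 := by ring
        linarith)
    refine ⟨n, hn1, hn2, G, hG, fun M hM => ⟨(hGM M hM).1, le_trans ?_ (hGM M hM).2⟩⟩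
    -- From `K * η ≥ α / 15`, while `α + η + 1` exceeds `α` only slightly because `9 * η ≤ α`.
    have h1 : 1 / 17 ≤ (η : ℝ) / (α + η + 1) * K := by
      rw [div_mul_eq_mul_div, le_div_iff₀ (by linarith)]
      nlinarith
    have h2 : ε * Real.logb 2 α ≤ ε * (2 * Real.logb 2 η) := by gcongr
    -- Up to 18 the claimed bound is not positive.
    by_cases hneg : ε * Real.logb 2 α ≤ 18
    · refine le_trans (by linarith : _ ≤ (0 : ℝ)) ?_
      have : (0 : ℝ) ≤ (d : ℝ) - 1 := by linarith
      positivity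
    · have h3 : 1 / 17 * ((d : ℝ) - 1) ≤ (η : ℝ) / (α + η + 1) * K * (d - 1) := by
        gcongr
      linarith
  · intro ε hε hε1
    -- With exponent `2 * ε`, `η * P ^ 4 = (η ^ (1 / 2 + ε)) ^ 2 ≤ α ^ 2`, which is what the
    -- condition needs when `k = 0` removes the term linear in `η`.
    obtain ⟨N, hN⟩ := exists_height (e := 2 * ε) (by linarith) (by linarith)
    refine ⟨N, fun η hη α hα1 hα2 => ?_⟩
    obtain ⟨d, hη100, hd, hdlog, hS, hP⟩ := hN η hη
    have hηR : (100 : ℝ) ≤ η := by exact_mod_cast hη100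
    have hη0 : (0 : ℝ) < η := by linarith
    have hα1' : 1 ≤ α := (Real.one_le_rpow (by linarith) (by linarith)).trans hα1
    have hα0 : 0 < α := by linarith
    have hdR : (1 : ℝ) ≤ d := by exact_mod_cast hd
    have hP4 : ((η : ℝ) ^ (2 * ε / 4)) ^ 4 = (η : ℝ) ^ (2 * ε) := by
      rw [← Real.rpow_natCast, ← Real.rpow_mul hη0.le]
      congr 1
      push_cast
      ring
    have hPη : ((η : ℝ) ^ (2 * ε / 4)) ^ 4 ≤ η := by
      rw [hP4]
      exact (Real.rpow_le_rpow_of_exponent_le (by linarith) (by linarith : 2 * ε ≤ 1)).trans_eq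
        (Real.rpow_one _)
    have hPα : η * ((η : ℝ) ^ (2 * ε / 4)) ^ 4 ≤ α ^ 2 := by
      have h1 : η * ((η : ℝ) ^ (2 * ε / 4)) ^ 4 = ((η : ℝ) ^ (1 / 2 + ε)) ^ 2 := by
        rw [hP4, ← Real.rpow_natCast _ 2, ← Real.rpow_mul hη0.le, ← Real.rpow_one_add' hη0.le]
        · congr 1
          push_cast
          ring
        · positivity
      rw [h1]
      gcongr
    have hlog : Real.logb 2 α ≤ Real.logb 2 η :=
      Real.logb_le_logb_of_le (by norm_num) hα0 hα2
    generalize (η : ℝ) ^ (2 * ε / 4) = P at *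
    have hP0 : 0 < P := by nlinarith
    set t : ℕ := (0 + 1) * (2 ^ d - 1) with ht
    have htR : (t : ℝ) ≤ P ^ 3 := by
      have h1 : t ≤ 2 ^ d := by
        rw [ht, zero_add, one_mul]
        exact Nat.sub_le _ _
      have h2 : (t : ℝ) ≤ 2 ^ d := by exact_mod_cast h1
      exact h2.trans hS
    have ht4 : 4 * t ≤ η := by
      have : 4 * (t : ℝ) ≤ η := by
        calc 4 * (t : ℝ) ≤ P * P ^ 3 := by
              gcongr
              nlinarith
          _ = P ^ 4 := by ring
          _ ≤ η := hPη
      exact_mod_cast this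
    obtain ⟨n, hn1, hn2, G, hG, hGM⟩ := exists_isBNE_tree (η := η) (d := d) (k := 0) (α := α)
      hα1' hd ht4 (by
        rw [Nat.cast_zero, mul_zero, zero_mul, zero_add, zero_add, one_mul]
        have e0 : 1 ≤ η / α := by rwa [le_div_iff₀ hα0, one_mul]
        have e1 : 2 + 3 * d * η / α ≤ 5 * d * (η / α) := by
          have : 1 ≤ d * (η / α) := one_le_mul_of_one_le_of_one_le hdR e0
          have h : 3 * d * η / α = 3 * (d * (η / α)) := by ring
          rw [h]
          linarith
        have e3 : (2 + 3 * d * η / α) * (2 * t * d) ≤ (5 * d * (η / α)) * (2 * P ^ 3 * d) := by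
          gcongr
        refine e3.trans_lt ?_
        have e4 : (5 * d * (η / α)) * (2 * P ^ 3 * d) = (η * P ^ 3) * (10 * d ^ 2) / α := by ring
        rw [e4, div_lt_iff₀ hα0]
        calc (η * P ^ 3) * (10 * (d : ℝ) ^ 2) < (η * P ^ 3) * P := by
              gcongr
              nlinarith
          _ = η * P ^ 4 := by ring
          _ ≤ α ^ 2 := hPα
          _ = α * α := by ring)
    refine ⟨n, hn1, hn2, G, hG, fun M hM => ⟨(hGM M hM).1, le_trans ?_ (hGM M hM).2⟩⟩
    have h1 : 0.49 ≤ (η : ℝ) / (α + η + 1) := by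
      rw [le_div_iff₀ (by linarith)]
      linarith
    have h2 : ε * Real.logb 2 α ≤ ε * Real.logb 2 η := by gcongr
    have h0 : 0 ≤ ε * Real.logb 2 η :=
      mul_nonneg hε.le (Real.logb_nonneg (by norm_num) (by linarith))
    have h3 : 0.49 * ((d : ℝ) - 1) ≤ (η : ℝ) / (α + η + 1) * (d - 1) := by
      gcongr
    push_cast
    linarith
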